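/- **Conventions.** Let $\Sigma$ be a finite alphabet with two distinct symbols $0,1\in\Sigma$. A multi-function $f:A\rightrightarrows B$ assigns to every $a\in A$ a set $f(a)\subseteq B$; $\mathrm{dom}(f)=\{a: f(a)\neq\emptyset\}$; it is a partial function if every $f(a)$ has at most one element. A *generalized multi-representation* of $B$ is a multi-function $\delta:U\rightrightarrows B$ with $\bigcup_{u}\delta(u)=B$; it is a *multi-representation* if $U=\Sigma^\omega$. The relational composition is $(\delta\odot\gamma)(x)=\{z:\exists y\,(y\in\gamma(x)\wedge z\in\delta(y))\}$. For $f:X_1\times\dots\times X_n\rightrightarrows X_0$, $g:Y_1\times\dots\times Y_n\rightrightarrows Y_0$ and $\gamma_i:X_i\rightrightarrows Y_i$, $f$ *realizes* $g$ via $(\gamma_1,\dots,\gamma_n,\gamma_0)$ if for all $x,y$ with $y_j\in\gamma_j(x_j)$ $(1\le j\le n)$ and $y\in\mathrm{dom}(g)$ we have $f(x)\neq\emptyset$ and $g(y)\cap\gamma_0(x_0)\neq\emptyset$ for all $x_0\in f(x)$. A partial function from $(\Sigma^\omega)^n$ to $\Sigma^\omega$ or to $\Sigma^*$ is *computable* if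 it has an extension computed by a Type-2 machine. If $\gamma_j:\Sigma^\omega\rightrightarrows Y_j$ are multi-representations, $g:Y_1\times\dots\times Y_n\rightrightarrows Y_0$ is $(\gamma_1,\dots,\gamma_n,\gamma_0)$-*computable* if some computable partial function $(\Sigma^\omega)^n\to\Sigma^\omega$ realizes $g$ via $(\gamma_1,\dots,\gamma_n,\gamma_0)$; likewise, with the identity $I_*$ on $\Sigma^*$ in place of $\gamma_0$ and computable partial functions $(\Sigma^\omega)^n\to\Sigma^*$, if $g$ has values in $\Sigma^*$. **Machines.** A generalized Turing machine $M$ has a finite set of labels with an initial label $l_0$ and a final label $l_f$, a finite work alphabet $\Gamma$ with a blank symbol, numbers $k\le L$, tapes $0,\dots,L$ (tape $0$ is the output tape, tapes $1,\dots,k$ are the input tapes) with sets $X_0,\dots,X_L$ disjoint from $\Gamma$, and for every label $l\ne l_f$ one of the statements: move the head of tape $i$ right or left and go to $l'$; write $a\in\Gamma$ on tape $i$ and go to $l'$; if tape $i$ scans $a\in\Gamma$ then go to $l'$, else to $l''$; $(i:=f(i_1,\dots,i_n),l')$ with a multi-function $f:X_{i_1}\times\dots\times X_{i_n}\rightrightarrows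 X_i$; (if $f(i_1,\dots,i_n)$ then $l'$, else $l''$) with a partial function $f:X_{i_1}\times\dots\times X_{i_n}\to\{0,1\}\subseteq\Sigma^*$ (value $0$ leads to $l'$, value $1$ to $l''$). Each cell (indexed by $\mathbb Z$) of tape $i$ holds an element of $X_i\cup\Gamma$; an assignment writes any element of $f(x_{i_1},\dots,x_{i_n})$, where $x_j$ is the content scanned on tape $j$; if $f(x_{i_1},\dots,x_{i_n})$ is undefined or empty there is no successor configuration. Initially the label is $l_0$, all heads are at position $0$, cell $0$ of input tape $i$ contains $x_i$, and all other cells are blank. A configuration is accepting if its label is $l_f$ and cell $0$ of tape $0$ contains an element of $X_0$, which is then the result. The multi-function $f_M:X_1\times\dots\times X_k\rightrightarrows X_0$ computed by $M$ is defined by: $x_0\in f_M(x)$ iff every maximal computation on input $x$ is finite and ends in an accepting configuration, and some accepting computation on input $x$ has the result $x_0$. **Theorem t5.** Let $P$ be a generalized Turing machine with tape sets $(Z_i)_{0\le i\le L}$. For $0\le i\le L$ let $\delta_i:Y_i\rightrightarrows Z_i$ be a generalized multi-representation and $\gamma_i:\Sigma^\omega\rightrightarrows Y_i$ a multi-representation.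 Suppose that 1. for every statement $(i:=f(i_1,\dots,i_n),l')$ of $P$, $f$ has a realization $g$ via $(\delta_{i_1},\dots,\delta_{i_n},\delta_i)$ that is $(\gamma_{i_1},\dots,\gamma_{i_n},\gamma_i)$-computable; 2. for every statement (if $f(i_1,\dots,i_n)$ then $l'$, else $l''$) of $P$, $f$ has a realization $g$ via $(\delta_{i_1},\dots,\delta_{i_n},I_*)$ that is $(\gamma_{i_1},\dots,\gamma_{i_n},I_*)$-computable. Then there is a generalized Turing machine $M$ with tape sets $(Y_i)_{0\le i\le L}$ obtained from $P$ by replacing every function or test $f$ by some $g$ as in 1. and 2., and for every such $M$: (a) $f_M$ is $(\gamma_1,\dots,\gamma_k,\gamma_0)$-computable; (b) $f_M$ realizes $f_P$ via $(\delta_1,\dots,\delta_k,\delta_0)$. Moreover, (c) $f_P$ is $(\delta_1\odot\gamma_1,\dots,\delta_k\odot\gamma_k,\delta_0\odot\gamma_0)$-computable. -/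

import Mathlib

universe u v w z

/-! ## Multi-functions, multi-representations, realization -/

/-- A multi-function `f : A ⇉ B`; `f a` is the set of acceptable values at `a`,
and the domain of `f` is the set of all `a` for which `f a` is nonempty. -/
abbrev MultiFun (A : Type u) (B : Type v) : Type (max u v) := A → Set B

/-- A multi-function is an (ordinary) partial function if it has at most one value everywhere. -/
def MultiFun.IsPartialFun {A : Type u} {B : Type v} (f : MultiFun A B) : Prop :=
  ∀ a, (f a).Subsingleton

/-- A multi-function `U ⇉ B` is a generalized multi-representation of `B` if its range is
all of `B`. It is a multi-representation if `U` is the set of infinite sequences over the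
alphabet. -/
def MultiFun.IsMultiRep {U : Type u} {B : Type v} (γ : MultiFun U B) : Prop :=
  ∀ b, ∃ a, b ∈ γ a

/-- The relational composition `δ ⊙ γ`. -/
def MultiFun.relComp {A : Type u} {B : Type v} {C : Type w}
    (δ : MultiFun B C) (γ : MultiFun A B) : MultiFun A C :=
  fun x => {z | ∃ y, y ∈ γ x ∧ z ∈ δ y}

/-- `Realizes γ γ₀ f g`: the multi-function `f : X₁ × ⋯ × Xₙ ⇉ X₀` realizes
`g : Y₁ × ⋯ × Yₙ ⇉ Y₀` via `(γ₁, …, γₙ, γ₀)`, where `γᵢ : Xᵢ ⇉ Yᵢ`. -/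
def Realizes {n : ℕ} {X : Fin n → Type u} {Y : Fin n → Type v} {X₀ : Type w} {Y₀ : Type z}
    (γ : ∀ j, MultiFun (X j) (Y j)) (γ₀ : MultiFun X₀ Y₀)
    (f : MultiFun (∀ j, X j) X₀) (g : MultiFun (∀ j, Y j) Y₀) : Prop :=
  ∀ (x : ∀ j, X j) (y : ∀ j, Y j), (∀ j, y j ∈ γ j (x j)) → (g y).Nonempty →
    (f x).Nonempty ∧ ∀ x₀ ∈ f x, (g y ∩ γ₀ x₀).Nonempty

/-! ## Type-2 machines and computable functions on infinite sequences -/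

/-- A finite alphabet with two distinguished distinct symbols `0` and `1`. Finite words over
`A` are elements of `List A`, infinite sequences over `A` are functions `ℕ → A`. -/
class Alphabet (A : Type) where
  /-- the alphabet is finite -/
  finite : Finite A
  /-- the symbol `0` -/
  zero : A
  /-- the symbol `1` -/
  one : A
  zero_ne_one : zero ≠ one

/-- The word `0` (of length one). -/
def wordZero (A : Type) [Alphabet A] : List A := [Alphabet.zero]

/-- The word `1` (of length one). -/
def wordOne (A : Type) [Alphabet A] : List A := [Alphabet.one]

/-- The action of a Type-2 machine in one step: the next state, which input heads advance by
one cell, what is written on each work tape and how its head moves afterwards (`none`: it does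
not move), and the symbol, if any, that is appended to the output. -/
structure Type2Action (A State Work : Type) (n m : ℕ) where
  next : State
  advance : Fin n → Bool
  work : Fin m → Work × Option Turing.Dir
  emit : Option A

/-- A Type-2 machine with `n` one-way read-only input tapes carrying infinite sequences over
`A`, finitely many two-way work tapes, and a one-way write-only output tape. The transition
function sees the state, the scanned input symbols, and the scanned work symbols; the machine
halts when the transition is `none`. The blank symbol of the work tapes is the default element
of the work alphabet. -/
structure Type2Machine (A : Type) (n : ℕ) where
  State : Type
  stateFinite : Finite State
  start : State
  Work : Type
  workFinite : Finite Work
  workBlank : Inhabited Work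
  m : ℕ
  trans : State → (Fin n → A) → (Fin m → Work) → Option (Type2Action A State Work n m)

namespace Type2Machine

attribute [instance] Type2Machine.workBlank

variable {A : Type} {n : ℕ}

/-- Configurations: state, positions of the input heads, work tapes (with their heads), and
the word written so far on the output tape. -/
structure Cfg (M : Type2Machine A n) where
  state : M.State
  pos : Fin n → ℕ
  work : Fin M.m → Turing.Tape M.Work
  out : List A

/-- The initial configuration. -/
def init (M : Type2Machine A n) : M.Cfg :=
  { state := M.start, pos := fun _ => 0, work := fun _ => default, out := [] }

/-- The result of performing an action. -/
def act (M : Type2Machine A n) (a : Type2Action A M.State M.Work n M.m) (c : M.Cfg) : M.Cfg where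
  state := a.next
  pos j := if a.advance j then c.pos j + 1 else c.pos j
  work r :=
    match (a.work r).2 with
    | none => (c.work r).write (a.work r).1
    | some d => ((c.work r).write (a.work r).1).move d
  out := c.out ++ a.emit.toList

/-- One step on input `p`; `none` means that the machine halts in configuration `c`. -/
def step (M : Type2Machine A n) (p : Fin n → ℕ → A) (c : M.Cfg) : Option M.Cfg :=
  (M.trans c.state (fun j => p j (c.pos j)) (fun r => (c.work r).head)).map fun a => M.act a c

/-- The configuration after `t` steps on input `p`, if the machine has not halted before. -/
def run (M : Type2Machine A n) (p : Fin n → ℕ → A) : ℕ → Option M.Cfg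
  | 0 => some M.init
  | t + 1 => (M.run p t).bind (M.step p)

/-- The function with values in the set of words computed by the machine: `w` is its value at
`p` iff the machine halts on input `p` with `w` on the output tape. -/
def wordFun (M : Type2Machine A n) : MultiFun (Fin n → ℕ → A) (List A) :=
  fun p => {w | ∃ t c, M.run p t = some c ∧ M.step p c = none ∧ c.out = w}

/-- The function with values in the set of infinite sequences computed by the machine: `q` is
its value at `p` iff the machine computes forever on input `p` and writes `q` on the output
tape. -/
def seqFun (M : Type2Machine A n) : MultiFun (Fin n → ℕ → A) (ℕ → A) :=
  fun p => {q |
    (∀ t, ∃ c, M.run p t = some c ∧ c.out = (List.range c.out.length).map q) ∧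
    (∀ N, ∃ t c, M.run p t = some c ∧ N ≤ c.out.length)}

end Type2Machine

/-- A partial function from tuples of infinite sequences to words is computable if it has an
extension that is computed by a Type-2 machine. -/
def IsComputableWordFun {A : Type} {n : ℕ} (f : MultiFun (Fin n → ℕ → A) (List A)) : Prop :=
  f.IsPartialFun ∧ ∃ M : Type2Machine A n, ∀ p, ∀ w ∈ f p, w ∈ M.wordFun p

/-- A partial function from tuples of infinite sequences to infinite sequences is computable
if it has an extension that is computed by a Type-2 machine. -/
def IsComputableSeqFun {A : Type} {n : ℕ} (f : MultiFun (Fin n → ℕ → A) (ℕ → A)) : Prop :=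
  f.IsPartialFun ∧ ∃ M : Type2Machine A n, ∀ p, ∀ q ∈ f p, q ∈ M.seqFun p

/-- The identity on words, as a (multi-)representation of the set of words by itself. -/
def idWord (A : Type) : MultiFun (List A) (List A) := fun w => {w}

/-- `g : Y₁ × ⋯ × Yₙ ⇉ Y₀` is `(γ₁, …, γₙ, γ₀)`-computable: it has a computable realization on
infinite sequences. -/
def RelComputable {A : Type} {n : ℕ} {Y : Fin n → Type u} {Y₀ : Type v}
    (γ : ∀ j, MultiFun (ℕ → A) (Y j)) (γ₀ : MultiFun (ℕ → A) Y₀)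
    (g : MultiFun (∀ j, Y j) Y₀) : Prop :=
  ∃ h : MultiFun (Fin n → ℕ → A) (ℕ → A), IsComputableSeqFun h ∧
    Realizes (X := fun _ => ℕ → A) γ γ₀ h g

/-- The word-valued `g` is `(γ₁, …, γₙ, id)`-computable, where `id` is the identity on words. -/
def RelComputableWord {A : Type} {n : ℕ} {Y : Fin n → Type u}
    (γ : ∀ j, MultiFun (ℕ → A) (Y j)) (g : MultiFun (∀ j, Y j) (List A)) : Prop :=
  ∃ h : MultiFun (Fin n → ℕ → A) (List A), IsComputableWordFun h ∧
    Realizes (X := fun _ => ℕ → A) γ (idWord A) h g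

/-! ## Generalized Turing machines -/

/-- The data of a generalized Turing machine apart from the tape sets and the statements:
a finite set of labels with an initial and a final label, a finite work alphabet `Γ` with a
blank symbol, and the numbers `k ≤ L`. The tapes are numbered `0, …, L`; tape `0` is the output
tape and the tapes `1, …, k` are the input tapes. -/
structure GTMFrame where
  Label : Type
  labelFinite : Finite Label
  start : Label
  final : Label
  Γ : Type
  symFinite : Finite Γ
  blank : Γ
  k : ℕ
  L : ℕ
  k_le : k ≤ L

/-- The tape carrying the input number `j` (counted from `0`), i.e. tape `j + 1`. -/
def GTMFrame.inTape (F : GTMFrame) (j : Fin F.k) : Fin (F.L + 1) :=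
  (Fin.castLE F.k_le j).succ

/-- The statements of a generalized Turing machine with tape sets `X₀, …, X_L`:
* `right i l'`, `left i l'`: move the head on tape `i`, go to `l'`;
* `write i a l'`: write the symbol `a ∈ Γ` on tape `i`, go to `l'`;
* `ifSym i a l' l''`: if `a ∈ Γ` is scanned on tape `i` go to `l'`, else to `l''`;
* `assign i t f l'`: the assignment `i := f(t₁, …, tₙ)` with a multi-function `f`, go to `l'`;
* `test t f l' l''`: if `f(t₁, …, tₙ)` then `l'` else `l''`, for a partial function `f` whose
  values are among the words `0` (true) and `1` (false). -/
inductive Stmt (A : Type) [Alphabet A] (F : GTMFrame) (X : Fin (F.L + 1) → Type u) : Type u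
  | right (i : Fin (F.L + 1)) (l' : F.Label)
  | left (i : Fin (F.L + 1)) (l' : F.Label)
  | write (i : Fin (F.L + 1)) (a : F.Γ) (l' : F.Label)
  | ifSym (i : Fin (F.L + 1)) (a : F.Γ) (l' l'' : F.Label)
  | assign (i : Fin (F.L + 1)) {n : ℕ} (t : Fin n → Fin (F.L + 1))
      (f : MultiFun (∀ j, X (t j)) (X i)) (l' : F.Label)
  | test {n : ℕ} (t : Fin n → Fin (F.L + 1)) (f : MultiFun (∀ j, X (t j)) (List A))
      (partialFun : f.IsPartialFun) (range : ∀ x, f x ⊆ {wordZero A, wordOne A})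
      (l' l'' : F.Label)

/-- A generalized Turing machine: every label except the final one carries a statement. -/
structure GTM (A : Type) [Alphabet A] (F : GTMFrame) (X : Fin (F.L + 1) → Type u) where
  stm : {l : F.Label // l ≠ F.final} → Stmt A F X

namespace GTM

/-- Configurations: label, inscriptions of the tapes, head positions. A cell of tape `i`
contains an element of the disjoint union of `X i` and the work alphabet. -/
@[ext] structure Conf (F : GTMFrame) (X : Fin (F.L + 1) → Type u) where
  label : F.Label
  tape : ∀ i : Fin (F.L + 1), ℤ → X i ⊕ F.Γ
  head : Fin (F.L + 1) → ℤ

variable {A : Type} [Alphabet A] {F : GTMFrame} {X : Fin (F.L + 1) → Type u}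

/-- The content of the cell scanned by the head of tape `i`. -/
def Conf.scan (c : Conf F X) (i : Fin (F.L + 1)) : X i ⊕ F.Γ := c.tape i (c.head i)

/-- Change the label. -/
def Conf.goto (c : Conf F X) (l : F.Label) : Conf F X := { c with label := l }

/-- Move the head on tape `i` to position `m`. -/
def Conf.setHead (c : Conf F X) (i : Fin (F.L + 1)) (m : ℤ) : Conf F X :=
  { c with head := Function.update c.head i m }

/-- Write `x` under the head of tape `i`. -/
def Conf.setCell (c : Conf F X) (i : Fin (F.L + 1)) (x : X i ⊕ F.Γ) : Conf F X :=
  { c with tape := Function.update c.tape i (Function.update (c.tape i) (c.head i) x) }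

/-- `Exec s c c'`: executing the statement `s` can lead from `c` to `c'`. -/
def Exec : Stmt A F X → Conf F X → Conf F X → Prop
  | .right i l', c, c' => c' = (c.setHead i (c.head i + 1)).goto l'
  | .left i l', c, c' => c' = (c.setHead i (c.head i - 1)).goto l'
  | .write i a l', c, c' => c' = (c.setCell i (Sum.inr a)).goto l'
  | .ifSym i a l' l'', c, c' =>
      (c.scan i = Sum.inr a ∧ c' = c.goto l') ∨ (c.scan i ≠ Sum.inr a ∧ c' = c.goto l'')
  | .assign i t f l', c, c' =>
      ∃ x : ∀ j, X (t j), (∀ j, c.scan (t j) = Sum.inl (x j)) ∧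
        ∃ y ∈ f x, c' = (c.setCell i (Sum.inl y)).goto l'
  | .test t f _ _ l' l'', c, c' =>
      ∃ x : ∀ j, X (t j), (∀ j, c.scan (t j) = Sum.inl (x j)) ∧
        ((wordZero A ∈ f x ∧ c' = c.goto l') ∨ (wordOne A ∈ f x ∧ c' = c.goto l''))

/-- The successor relation on configurations. -/
def Step (M : GTM A F X) (c c' : Conf F X) : Prop :=
  ∃ h : c.label ≠ F.final, Exec (M.stm ⟨c.label, h⟩) c c'

/-- The initial configuration for the input `x`: all heads are at position `0`, the cell `0`
of each input tape contains the input, and all other cells are blank. -/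
def initConf (x : ∀ j : Fin F.k, X (F.inTape j)) : Conf F X where
  label := F.start
  tape i := Fin.cases (motive := fun i => ℤ → X i ⊕ F.Γ) (fun _ => Sum.inr F.blank)
    (fun i' m => if h : i'.1 < F.k ∧ m = 0 then Sum.inl (x ⟨i'.1, h.1⟩) else Sum.inr F.blank) i
  head _ := 0

/-- `c` is accepting with result `x₀`: the label is final and the cell `0` of tape `0`
contains `x₀ ∈ X₀`. -/
def AcceptsWith (c : Conf F X) (x₀ : X 0) : Prop :=
  c.label = F.final ∧ c.tape 0 0 = Sum.inl x₀

/-- Accepting configurations. -/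
def Accepting (c : Conf F X) : Prop := ∃ x₀, AcceptsWith c x₀

/-- Every maximal computation from `c` is accepting: there is no infinite computation from
`c`, and every finite computation from `c` whose last configuration has no successor ends in
an accepting configuration. -/
def AllMaximalAccepting (M : GTM A F X) (c : Conf F X) : Prop :=
  (¬ ∃ s : ℕ → Conf F X, s 0 = c ∧ ∀ n, M.Step (s n) (s (n + 1))) ∧
  ∀ c', Relation.ReflTransGen M.Step c c' → (∀ c'', ¬ M.Step c' c'') → Accepting c'

/-- The multi-function `f_M : X₁ × ⋯ × X_k ⇉ X₀` computed by `M`. -/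
def computes (M : GTM A F X) : MultiFun (∀ j : Fin F.k, X (F.inTape j)) (X 0) :=
  fun x => {x₀ | M.AllMaximalAccepting (initConf x) ∧
    ∃ c, Relation.ReflTransGen M.Step (initConf x) c ∧ AcceptsWith c x₀}

end GTM

/-- `StmtReplaces γ δ s s'`: the statement `s` (on the sets `Y i`) is equal to the statement `s'`
(on the sets `Z i`), except that the function `f` in `s'`, if any, is replaced by a function
`g` that realizes `f` via the `δ i` and is computable with respect to the `γ i`. -/
inductive StmtReplaces {A : Type} [Alphabet A] {F : GTMFrame} {Y : Fin (F.L + 1) → Type u}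
    {Z : Fin (F.L + 1) → Type v} (γ : ∀ i, MultiFun (ℕ → A) (Y i))
    (δ : ∀ i, MultiFun (Y i) (Z i)) : Stmt A F Y → Stmt A F Z → Prop
  | right (i : Fin (F.L + 1)) (l' : F.Label) : StmtReplaces γ δ (.right i l') (.right i l')
  | left (i : Fin (F.L + 1)) (l' : F.Label) : StmtReplaces γ δ (.left i l') (.left i l')
  | write (i : Fin (F.L + 1)) (a : F.Γ) (l' : F.Label) :
      StmtReplaces γ δ (.write i a l') (.write i a l')
  | ifSym (i : Fin (F.L + 1)) (a : F.Γ) (l' l'' : F.Label) :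
      StmtReplaces γ δ (.ifSym i a l' l'') (.ifSym i a l' l'')
  | assign (i : Fin (F.L + 1)) {n : ℕ} (t : Fin n → Fin (F.L + 1))
      (g : MultiFun (∀ j, Y (t j)) (Y i)) (f : MultiFun (∀ j, Z (t j)) (Z i)) (l' : F.Label)
      (realizes : Realizes (fun j => δ (t j)) (δ i) g f)
      (computable : RelComputable (fun j => γ (t j)) (γ i) g) :
      StmtReplaces γ δ (.assign i t g l') (.assign i t f l')
  | test {n : ℕ} (t : Fin n → Fin (F.L + 1))
      (g : MultiFun (∀ j, Y (t j)) (List A)) (hg : g.IsPartialFun)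
      (hg' : ∀ x, g x ⊆ {wordZero A, wordOne A})
      (f : MultiFun (∀ j, Z (t j)) (List A)) (hf : f.IsPartialFun)
      (hf' : ∀ x, f x ⊆ {wordZero A, wordOne A}) (l' l'' : F.Label)
      (realizes : Realizes (fun j => δ (t j)) (idWord A) g f)
      (computable : RelComputableWord (fun j => γ (t j)) g) :
      StmtReplaces γ δ (.test t g hg hg' l' l'') (.test t f hf hf' l' l'')

/-- `M` is obtained from `P` by replacing every function `f` by a function `g` that realizes
`f` via the `δ i` and is computable with respect to the `γ i`. -/
def GTM.ObtainedFrom {A : Type} [Alphabet A] {F : GTMFrame} {Y : Fin (F.L + 1) → Type u}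
    {Z : Fin (F.L + 1) → Type v} (γ : ∀ i, MultiFun (ℕ → A) (Y i))
    (δ : ∀ i, MultiFun (Y i) (Z i)) (M : GTM A F Y) (P : GTM A F Z) : Prop :=
  ∀ l, StmtReplaces γ δ (M.stm l) (P.stm l)

/-! Parts (a) and (b) use one simulation principle. Let two machines with the same frame be in
corresponding configurations: equal labels, equal head positions, cell contents related by the
representations. If every function is replaced by a realization, then wherever the original
statement can be executed, so can the new one, and each outcome of the new one is matched by some
outcome of the original (`StmtSim`). The matching value of the original is chosen after the new
value is known, so every computation of the new machine lifts to one of the original machine: an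
infinite one to an infinite one, a maximal one to an accepting one. This is `realizes_computes`, and
it gives (b).

For (a) the principle is applied a second time, via the `γ i`: the functions of `M` are replaced by
functions computed by Type-2 machines (`exists_stmt_on_sequences`). The resulting machine has
infinite sequences in its cells and is deterministic, and it remains to see that it computes a
Type-2 computable function (`isComputableSeqFun_computes`). The reason is continuity. Replace the
sequences in the cells by finite prefixes. Each statement then acts primitive recursively on finite
data: the answer is never wrong, and it is as precise as desired if the given prefixes and the time
spent on Type-2 machines are large enough (`StmtApprox`). A halting computation has finitely many
steps, so the precision demanded of its result translates into a precision of the input. Hence `N`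
steps on prefixes of length `N` yield a primitive recursive function whose values are prefixes of
the result, with lengths tending to infinity.

Such a function is turned into a Type-2 machine by `exists_type2Machine_of_primrec`. The machine
works in rounds; each round reads one symbol of every input, evaluates a code by a stack machine,
and writes at most one letter.

Part (c) composes the two realizations (`RelComputable.relComp`). -/

/-! ## Words approximating infinite sequences -/

/-- The word `w` is a prefix of the infinite sequence `q`. -/
def SeqPrefix {A : Type*} (w : List A) (q : ℕ → A) : Prop :=
  ∀ i a, w[i]? = some a → a = q i

theorem seqPrefix_iff {A : Type*} {w : List A} {q : ℕ → A} :
    SeqPrefix w q ↔ w = (List.range w.length).map q := by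
  constructor
  · intro h
    apply List.ext_getElem (by simp)
    intro i h₁ h₂
    simpa using h i _ (List.getElem?_eq_getElem h₁)
  · intro h i a hi
    rw [h] at hi
    simp only [List.getElem?_map, Option.map_eq_some_iff] at hi
    obtain ⟨b, hb, rfl⟩ := hi
    obtain ⟨_, rfl⟩ := List.getElem?_eq_some_iff.1 hb
    simp

theorem SeqPrefix.of_prefix {A : Type*} {w w' : List A} {q : ℕ → A} (h : SeqPrefix w' q)
    (hw : w <+: w') : SeqPrefix w q :=
  by
  obtain ⟨t, rfl⟩ := hw
  intro i a hi
  refine h i a ?_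
  rwa [List.getElem?_append_left (List.getElem?_eq_some_iff.1 hi).1]

theorem seqPrefix_nil {A : Type*} (q : ℕ → A) : SeqPrefix [] q := by
  intro i a h; simp at h

/-- The first `N` columns of a tuple of infinite sequences. -/
def columns {A : Type*} {n : ℕ} (p : Fin n → ℕ → A) (N : ℕ) : List (Fin n → A) :=
  (List.range N).map fun i j => p j i

@[simp] theorem columns_zero {A : Type*} {n : ℕ} (p : Fin n → ℕ → A) : columns p 0 = [] := rfl

theorem columns_succ {A : Type*} {n : ℕ} (p : Fin n → ℕ → A) (N : ℕ) :
    columns p (N + 1) = columns p N ++ [fun j => p j N] := by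
  simp [columns, List.range_succ]

@[simp] theorem columns_length {A : Type*} {n : ℕ} (p : Fin n → ℕ → A) (N : ℕ) :
    (columns p N).length = N := by
  simp [columns]

/-! ## Runs of Type-2 machines -/

namespace Type2Machine

variable {A : Type} {n : ℕ}

/-- The successor relation of a Type-2 machine on input `p`. -/
def Next (M : Type2Machine A n) (p : Fin n → ℕ → A) (c c' : M.Cfg) : Prop := M.step p c = some c'

theorem run_add_of_transGen {M : Type2Machine A n} {p : Fin n → ℕ → A} {c c' : M.Cfg}
    (h : Relation.TransGen (M.Next p) c c') {t : ℕ} (ht : M.run p t = some c) :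
    ∃ t', t < t' ∧ M.run p t' = some c' := by
  induction h with
  | single h => exact ⟨t + 1, by omega, by simpa [run, ht, Next] using h⟩
  | tail _ h ih =>
    obtain ⟨t', h₁, h₂⟩ := ih
    exact ⟨t' + 1, by omega, by simpa [run, h₂, Next] using h⟩

theorem out_prefix_of_step {M : Type2Machine A n} {p : Fin n → ℕ → A} {c c' : M.Cfg}
    (h : M.step p c = some c') : c.out <+: c'.out := by
  simp only [step, Option.map_eq_some_iff] at h
  obtain ⟨a, _, rfl⟩ := h
  exact List.prefix_append _ _

theorem run_prefix {M : Type2Machine A n} {p : Fin n → ℕ → A} {t t' : ℕ} (htt : t ≤ t')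
    {c' : M.Cfg} (h : M.run p t' = some c') : ∃ c, M.run p t = some c ∧ c.out <+: c'.out := by
  induction t', htt using Nat.le_induction generalizing c' with
  | base => exact ⟨c', h, List.prefix_rfl⟩
  | succ s _ ih =>
    simp only [run, Option.bind_eq_some_iff] at h
    obtain ⟨d, hd, hs⟩ := h
    obtain ⟨c, hc, hp⟩ := ih hd
    exact ⟨c, hc, hp.trans (out_prefix_of_step hs)⟩

/-- The output only grows, and a run that reaches a late time has passed all earlier ones; control
at arbitrarily late times is therefore control at all times. -/
theorem mem_seqFun_of_frequently {M : Type2Machine A n} {p : Fin n → ℕ → A} {q : ℕ → A}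
    (h₁ : ∀ N, ∃ t c, N ≤ t ∧ M.run p t = some c ∧ SeqPrefix c.out q)
    (h₂ : ∀ N, ∃ t c, M.run p t = some c ∧ N ≤ c.out.length) : q ∈ M.seqFun p := by
  refine ⟨fun t => ?_, h₂⟩
  obtain ⟨t', c', htt, hr, hp⟩ := h₁ t
  obtain ⟨c, hc, hcp⟩ := run_prefix htt hr
  exact ⟨c, hc, seqPrefix_iff.1 (hp.of_prefix hcp)⟩

/-- The run depends on the input alone, and the letter at position `i` can be read off at any time
at which more than `i` letters have been written. -/
theorem seqFun_unique {M : Type2Machine A n} {p : Fin n → ℕ → A} {q q' : ℕ → A}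
    (h : q ∈ M.seqFun p) (h' : q' ∈ M.seqFun p) : q = q' := by
  funext i
  obtain ⟨t, c, hc, hi⟩ := h.2 (i + 1)
  have key : ∀ r, r ∈ M.seqFun p → c.out[i]? = some (r i) := by
    intro r hr
    obtain ⟨c', hc', ho⟩ := hr.1 t
    obtain rfl : c = c' := by simpa [hc] using hc'
    have hlt : i < c.out.length := hi
    rw [List.getElem?_eq_getElem hlt, seqPrefix_iff.2 ho i _ (List.getElem?_eq_getElem hlt)]
  simpa [key q h] using key q' h'

theorem run_none_of_halted {M : Type2Machine A n} {p : Fin n → ℕ → A} {t : ℕ} {c : M.Cfg}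
    (h : M.run p t = some c) (hs : M.step p c = none) {t' : ℕ} (ht : t < t') :
    M.run p t' = none := by
  induction t', ht using Nat.le_induction with
  | base => simp [run, h, hs]
  | succ s _ ih => simp [run, ih]

theorem wordFun_unique {M : Type2Machine A n} {p : Fin n → ℕ → A} {w w' : List A}
    (h : w ∈ M.wordFun p) (h' : w' ∈ M.wordFun p) : w = w' := by
  obtain ⟨t, c, hc, hs, rfl⟩ := h
  obtain ⟨t', c', hc', hs', rfl⟩ := h'
  rcases lt_trichotomy t t' with ht | rfl | ht
  · simp [run_none_of_halted hc hs ht] at hc'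
  · obtain rfl : c = c' := by simpa [hc] using hc'
    rfl
  · simp [run_none_of_halted hc' hs' ht] at hc

end Type2Machine

/-! ## Iterating codes for partial recursive functions on a Type-2 machine -/

namespace CodeMachine

set_option linter.unusedSectionVars false

open Turing Turing.PartrecToTM2

/-- Statements of the stack machine that evaluates codes. -/
abbrev St : Type := TM2.Stmt (fun _ : K' => Γ') Λ' (Option Γ')

/-- The stack machine that evaluates codes. -/
def prog (l : Λ') : St := tr l

/-- The work tape that carries a given stack. -/
def tapeOf : K' → Fin 4
  | .main => 0
  | .rev => 1
  | .aux => 2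
  | .stack => 3

/-- The stack carried by a given work tape. -/
def stackOf : Fin 4 → K' := ![.main, .rev, .aux, .stack]

@[simp] theorem stackOf_tapeOf (k : K') : stackOf (tapeOf k) = k := by cases k <;> rfl

theorem stackOf_eq_iff {r : Fin 4} {k : K'} : stackOf r = k ↔ r = tapeOf k := by
  constructor
  · rintro rfl
    revert r
    decide
  · rintro rfl
    simp

/-- The tape carrying a stack, with the head on the top of the stack. -/
def stackTape (l : List Γ') : Tape (Option Γ') := Tape.mk' ∅ (ListBlank.mk (l.map some))

@[simp] theorem stackTape_head (l : List Γ') : (stackTape l).head = l.head? := by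
  cases l <;> rfl

/-- An action writes before it moves, so a push takes two actions: the first rewrites the scanned
symbol and moves left, the second fills the fresh cell. -/
theorem stackTape_push (l : List Γ') (a : Γ') :
    (((stackTape l).write l.head?).move Dir.left).write (some a) = stackTape (a :: l) := by
  have h : (stackTape l).write l.head? = stackTape l := by
    rw [← stackTape_head, Tape.write_self]
  rw [h, stackTape, stackTape, Tape.move_left_mk', Tape.write_mk']
  rfl

/-- Erasing the popped cell keeps everything to the left of the head blank. On an empty stack the
head merely moves along a blank tape. -/
theorem stackTape_pop (l : List Γ') :
    ((stackTape l).write none).move Dir.right = stackTape l.tail := by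
  have h : stackTape l =
      Tape.mk' ∅ ((ListBlank.mk (l.tail.map some)).cons l.head?) := by
    cases l with
    | nil =>
      simp only [stackTape, List.map_nil, List.tail_nil, List.head?_nil]
      congr 1
      exact (ListBlank.cons_head_tail (ListBlank.mk [])).symm
    | cons a l => rfl
  rw [h, Tape.write_mk', Tape.move_right_mk']
  simp only [ListBlank.head_cons, ListBlank.tail_cons, stackTape]
  congr 1
  exact ListBlank.cons_head_tail ∅

/-- Data for a machine that, in round `N`, reads a column of the input and evaluates the code
given by this column and by the residue class of `N` on the number stored on its work tape. The
finite set `S` contains the statements of the stack machine which are used. -/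
structure Data (A : Type) (n m : ℕ) where
  code : (Fin n → A) → ZMod m → ToPartrec.Code
  letter : ZMod m → A
  S : Finset St
  start_mem : ∀ a i, prog (trNormal (code a i) Cont'.halt) ∈ S
  stmts_subset : ∀ x ∈ S, TM2.stmts₁ x ⊆ S
  goto_mem : ∀ l, TM2.Stmt.goto l ∈ S → ∀ v, prog (l v) ∈ S

variable {A : Type} {n m : ℕ}

/-- States: the residue class of the round, and either `none` (between two rounds), or a
statement to be executed, the local variable of the stack machine, and possibly a symbol that is
to be pushed first. -/
abbrev Data.State (D : Data A n m) : Type :=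
  ZMod m × Option (Option (K' × Γ') × Option Γ' × Option {x : St // x ∈ D.S})

open scoped Classical in
/-- A statement as a component of a state. -/
noncomputable def Data.wrap (D : Data A n m) (x : St) : Option {x : St // x ∈ D.S} :=
  if h : x ∈ D.S then some ⟨x, h⟩ else none

theorem Data.wrap_of_mem (D : Data A n m) {x : St} (h : x ∈ D.S) : D.wrap x = some ⟨x, h⟩ := by
  simp [Data.wrap, h]

/-- The action that changes only the state and work tape `r`. -/
def Data.local (D : Data A n m) (hd : Fin 4 → Option Γ') (s : D.State) (r : Fin 4)
    (x : Option Γ' × Option Dir) : Type2Action A D.State (Option Γ') n 4 where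
  next := s
  advance _ := false
  work r' := if r' = r then x else (hd r', none)
  emit := none

/-- The execution of one statement of the stack machine. -/
noncomputable def Data.exec (D : Data A n m) (i : ZMod m) (v : Option Γ') (hd : Fin 4 → Option Γ') :
    St → Type2Action A D.State (Option Γ') n 4
  | .push k f q => D.local hd (i, some (some (k, f v), v, D.wrap q)) (tapeOf k)
      (hd (tapeOf k), some Dir.left)
  | .peek k f q => D.local hd (i, some (none, f v (hd (tapeOf k)), D.wrap q)) 0 (hd 0, none)
  | .pop k f q => D.local hd (i, some (none, f v (hd (tapeOf k)), D.wrap q)) (tapeOf k)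
      (none, some Dir.right)
  | .load f q => D.local hd (i, some (none, f v, D.wrap q)) 0 (hd 0, none)
  | .branch f q₁ q₂ => D.local hd (i, some (none, v, D.wrap (cond (f v) q₁ q₂))) 0 (hd 0, none)
  | .goto f => D.local hd (i, some (none, v, D.wrap (prog (f v)))) 0 (hd 0, none)
  | .halt => D.local hd (i, none) 0 (hd 0, none)

/-- The transition function. -/
noncomputable def Data.trans (D : Data A n m) (s : D.State) (a : Fin n → A)
    (hd : Fin 4 → Option Γ') : Option (Type2Action A D.State (Option Γ') n 4) :=
  match s with
  | (i, none) => some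
      { next := (i + 1, some (none, none, D.wrap (prog (trNormal (D.code a (i + 1)) Cont'.halt))))
        advance := fun _ => true
        work := fun r => (hd r, none)
        emit := if hd 0 = some Γ'.bit1 then some (D.letter i) else none }
  | (i, some (some (k, b), v, x)) => some
      (D.local hd (i, some (none, v, x)) (tapeOf k) (some b, none))
  | (i, some (none, v, some x)) => some (D.exec i v hd x.1)
  | (_, some (none, _, none)) => none

theorem finite_K' : Finite K' :=
  Finite.of_injective tapeOf fun a b h => by simpa using congrArg stackOf h

/-- The machine. -/
noncomputable def Data.machine (D : Data A n m) [NeZero m] : Type2Machine A n where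
  State := D.State
  stateFinite := by
    have := finite_K'
    infer_instance
  start := (0, none)
  Work := Option Γ'
  workFinite := inferInstance
  workBlank := ⟨none⟩
  m := 4
  trans := D.trans

variable [NeZero m] (D : Data A n m) (p : Fin n → ℕ → A)

/-- A configuration of the machine. -/
def Data.raw (s : D.State) (pos : Fin n → ℕ) (T : Fin 4 → Tape (Option Γ'))
    (out : List A) : D.machine.Cfg where
  state := s
  pos := pos
  work := T
  out := out

/-- A configuration of the machine, given by the stacks. -/
def Data.cfg (s : D.State) (pos : Fin n → ℕ) (stk : K' → List Γ')
    (out : List A) : D.machine.Cfg :=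
  D.raw s pos (fun r => stackTape (stk (stackOf r))) out

/-- The state corresponding to a configuration of the stack machine. -/
noncomputable def Data.stateOf (i : ZMod m)
    (c : TM2.Cfg (fun _ : K' => Γ') Λ' (Option Γ')) : D.State :=
  (i, c.l.map fun l => (none, c.var, D.wrap (prog l)))

/-- Write a symbol and possibly move the head. -/
def writeMove (x : Option Γ' × Option Dir) (T : Tape (Option Γ')) : Tape (Option Γ') :=
  match x.2 with
  | none => T.write x.1
  | some d => (T.write x.1).move d

variable {D p} in
theorem Data.next_raw {s : D.State} {pos : Fin n → ℕ} {T : Fin 4 → Tape (Option Γ')}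
    {out : List A} {a : Type2Action A D.State (Option Γ') n 4}
    (h : D.trans s (fun j => p j (pos j)) (fun r => (T r).head) = some a) :
    D.machine.Next p (D.raw s pos T out)
      (D.raw a.next (fun j => if a.advance j then pos j + 1 else pos j)
        (fun r => writeMove (a.work r) (T r)) (out ++ a.emit.toList)) := by
  show (D.trans s (fun j => p j (pos j)) (fun r => (T r).head)).map _ = _
  rw [h]
  rfl

variable {D p} in
theorem Data.next_local {s s' : D.State} {pos : Fin n → ℕ} {T T' : Fin 4 → Tape (Option Γ')}
    {out : List A} {r : Fin 4} {x : Option Γ' × Option Dir}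
    (h : D.trans s (fun j => p j (pos j)) (fun r => (T r).head) =
      some (D.local (fun r => (T r).head) s' r x))
    (h₁ : T' r = writeMove x (T r)) (h₂ : ∀ r' ≠ r, T' r' = T r') :
    D.machine.Next p (D.raw s pos T out) (D.raw s' pos T' out) := by
  have e : D.raw s' pos T' out = D.raw s' (fun j => if false = true then pos j + 1 else pos j)
      (fun r' => writeMove (if r' = r then x else ((T r').head, none)) (T r'))
      (out ++ (none : Option A).toList) := by
    congr 1
    · funext r'
      split_ifs with hr
      · rw [hr, h₁]
      · rw [h₂ r' hr]
        exact (Tape.write_self _).symm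
    · simp
  rw [e]
  exact D.next_raw h

theorem Data.next_cfg {s s' : D.State} {pos : Fin n → ℕ} {stk stk' : K' → List Γ'} {out : List A}
    (k : K') {x : Option Γ' × Option Dir}
    (h : D.trans s (fun j => p j (pos j)) (fun r => (stk (stackOf r)).head?) =
      some (D.local (fun r => (stk (stackOf r)).head?) s' (tapeOf k) x))
    (h₁ : stackTape (stk' k) = writeMove x (stackTape (stk k))) (h₂ : ∀ k' ≠ k, stk' k' = stk k') :
    D.machine.Next p (D.cfg s pos stk out) (D.cfg s' pos stk' out) := by
  refine Data.next_local (r := tapeOf k) (x := x) ?_ ?_ ?_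
  · simpa using h
  · simpa using h₁
  · intro r hr
    rw [h₂ _ fun h => hr (stackOf_eq_iff.1 h)]

theorem writeMove_head (T : Tape (Option Γ')) : writeMove (T.head, none) T = T := Tape.write_self _

theorem Data.next_noop {s s' : D.State} {pos : Fin n → ℕ} {stk : K' → List Γ'} {out : List A}
    (h : D.trans s (fun j => p j (pos j)) (fun r => (stk (stackOf r)).head?) =
      some (D.local (fun r => (stk (stackOf r)).head?) s' 0 ((stk (stackOf 0)).head?, none))) :
    D.machine.Next p (D.cfg s pos stk out) (D.cfg s' pos stk out) := by
  refine D.next_cfg p .main h ?_ fun _ _ => rfl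
  rw [← stackTape_head]
  exact (writeMove_head _).symm

/-- Induction on the statement: every constructor costs one action, a push two. The second conjunct
keeps control inside the finite set `D.S`; outside of it `wrap` gives `none` and the machine would
halt. -/
theorem Data.stepAux_reaches (i : ZMod m) (pos : Fin n → ℕ) (out : List A) (x : St) (hx : x ∈ D.S)
    (v : Option Γ') (stk : K' → List Γ') :
    Relation.TransGen (D.machine.Next p)
      (D.cfg (i, some (none, v, D.wrap x)) pos stk out)
      (D.cfg (D.stateOf i (TM2.stepAux x v stk)) pos (TM2.stepAux x v stk).stk out) ∧
    ∀ l, (TM2.stepAux x v stk).l = some l → prog l ∈ D.S := by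
  induction x generalizing v stk with
  | push k f q ih =>
    have hq : q ∈ D.S := D.stmts_subset _ hx (by simp [TM2.stmts₁, TM2.stmts₁_self])
    obtain ⟨h₁, h₂⟩ := ih hq v (Function.update stk k (f v :: stk k))
    refine ⟨?_, h₂⟩
    have hs : ∀ r, r ≠ tapeOf k → Function.update stk k (f v :: stk k) (stackOf r) =
        stk (stackOf r) :=
      fun r hr => Function.update_of_ne (fun h => hr (stackOf_eq_iff.1 h)) _ _
    refine .head (b := D.raw (i, some (some (k, f v), v, D.wrap q)) pos
      (Function.update (fun r => stackTape (stk (stackOf r))) (tapeOf k)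
        (((stackTape (stk k)).write (stk k).head?).move Dir.left)) out) ?_ (.head ?_ h₁)
    · refine Data.next_local (r := tapeOf k) (x := ((stk k).head?, some Dir.left)) ?_ ?_ ?_
      · rw [D.wrap_of_mem hx]
        simp [Data.trans, Data.exec]
      · simp [writeMove]
      · intro r hr
        rw [Function.update_of_ne hr]
    · refine Data.next_local (r := tapeOf k) (x := (some (f v), none)) rfl ?_ ?_
      · simp [writeMove, stackTape_push]
      · intro r hr
        rw [Function.update_of_ne hr, hs r hr]
  | peek k f q ih =>
    have hq : q ∈ D.S := D.stmts_subset _ hx (by simp [TM2.stmts₁, TM2.stmts₁_self])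
    obtain ⟨h₁, h₂⟩ := ih hq (f v (stk k).head?) stk
    refine ⟨.head ?_ h₁, h₂⟩
    refine D.next_noop p ?_
    rw [D.wrap_of_mem hx]
    simp [Data.trans, Data.exec]
  | pop k f q ih =>
    have hq : q ∈ D.S := D.stmts_subset _ hx (by simp [TM2.stmts₁, TM2.stmts₁_self])
    obtain ⟨h₁, h₂⟩ := ih hq (f v (stk k).head?) (Function.update stk k (stk k).tail)
    refine ⟨.head ?_ h₁, h₂⟩
    refine D.next_cfg p k (x := (none, some Dir.right)) ?_ ?_ ?_
    · rw [D.wrap_of_mem hx]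
      simp [Data.trans, Data.exec]
    · simp [writeMove, stackTape_pop]
    · intro k' hk
      simp [hk]
  | load f q ih =>
    have hq : q ∈ D.S := D.stmts_subset _ hx (by simp [TM2.stmts₁, TM2.stmts₁_self])
    obtain ⟨h₁, h₂⟩ := ih hq (f v) stk
    refine ⟨.head ?_ h₁, h₂⟩
    refine D.next_noop p ?_
    rw [D.wrap_of_mem hx]
    simp [Data.trans, Data.exec]
  | branch f q₁ q₂ ih₁ ih₂ =>
    have hq₁ : q₁ ∈ D.S := D.stmts_subset _ hx (by simp [TM2.stmts₁, TM2.stmts₁_self])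
    have hq₂ : q₂ ∈ D.S := D.stmts_subset _ hx (by simp [TM2.stmts₁, TM2.stmts₁_self])
    have hs : D.machine.Next p (D.cfg (i, some (none, v, D.wrap (.branch f q₁ q₂))) pos stk out)
        (D.cfg (i, some (none, v, D.wrap (cond (f v) q₁ q₂))) pos stk out) := by
      refine D.next_noop p ?_
      rw [D.wrap_of_mem hx]
      simp [Data.trans, Data.exec]
    rcases hf : f v
    · rw [hf] at hs
      obtain ⟨h₁, h₂⟩ := ih₂ hq₂ v stk
      simp only [TM2.stepAux, hf, cond_false]
      exact ⟨.head hs h₁, h₂⟩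
    · rw [hf] at hs
      obtain ⟨h₁, h₂⟩ := ih₁ hq₁ v stk
      simp only [TM2.stepAux, hf, cond_true]
      exact ⟨.head hs h₁, h₂⟩
  | goto f =>
    refine ⟨.single (D.next_noop p ?_), ?_⟩
    · rw [D.wrap_of_mem hx]
      simp [Data.trans, Data.exec, Data.stateOf]
    · rintro l ⟨⟩
      exact D.goto_mem _ hx _
  | halt =>
    refine ⟨.single (D.next_noop p ?_), ?_⟩
    · rw [D.wrap_of_mem hx]
      simp [Data.trans, Data.exec, Data.stateOf]
    · rintro l ⟨⟩

theorem Data.reaches_of_reaches (i : ZMod m) (pos : Fin n → ℕ) (out : List A)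
    {c c' : TM2.Cfg (fun _ : K' => Γ') Λ' (Option Γ')}
    (h : StateTransition.Reaches (TM2.step prog) c c') (hc : ∀ l, c.l = some l → prog l ∈ D.S) :
    Relation.ReflTransGen (D.machine.Next p) (D.cfg (D.stateOf i c) pos c.stk out)
      (D.cfg (D.stateOf i c') pos c'.stk out) := by
  induction h using Relation.ReflTransGen.head_induction_on with
  | refl => exact .refl
  | @head c d h _ ih =>
    obtain ⟨l, v, S⟩ := c
    cases l with
    | none => simp at h
    | some l =>
      simp only [TM2.step, Option.mem_def, Option.some.injEq] at h
      subst h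
      obtain ⟨h₁, h₂⟩ := D.stepAux_reaches p i pos out (prog l) (hc l rfl) v S
      exact h₁.to_reflTransGen.trans (ih h₂)

/-- The letter `D.letter i` is governed by the bit on top of the main stack when the round begins,
that is, by the result of the previous round. The code evaluated now belongs to `i + 1`, because its
result decides about the letter of the next round. -/
theorem Data.round_reaches (i : ZMod m) (pos : Fin n → ℕ) (out : List A) {v v' : List ℕ}
    (h : (D.code (fun j => p j (pos j)) (i + 1)).eval v = pure v') :
    Relation.TransGen (D.machine.Next p)
      (D.cfg (i, none) pos (K'.elim (trList v) [] [] []) out)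
      (D.cfg (i + 1, none) (fun j => pos j + 1) (K'.elim (trList v') [] [] [])
        (out ++ if (trList v).head? = some Γ'.bit1 then [D.letter i] else [])) := by
  set c := D.code (fun j => p j (pos j)) (i + 1) with hc
  have hmem : halt v' ∈ StateTransition.eval (TM2.step prog) (init c v) := by
    have e : StateTransition.eval (TM2.step prog) (init c v) = halt <$> c.eval v := tr_eval c v
    rw [e, h]
    exact (Part.mem_map_iff _).2 ⟨v', Part.mem_some _, rfl⟩
  refine .head' ?_ (D.reaches_of_reaches p (i + 1) (fun j => pos j + 1) _
    (StateTransition.mem_eval.1 hmem).1 ?_)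
  · have h' := Data.next_raw (p := p) (D := D) (s := (i, none)) (pos := pos) (out := out)
      (T := fun r => stackTape (K'.elim (trList v) [] [] [] (stackOf r))) rfl
    have e : (if (trList v).head? = some Γ'.bit1 then [D.letter i] else []) =
        (if (stackTape (trList v)).head = some Γ'.bit1 then some (D.letter i) else none).toList := by
      rw [stackTape_head]
      split_ifs <;> rfl
    rw [e]
    exact h'
  · rintro l ⟨⟩
    exact D.start_mem _ _

open scoped Classical in
/-- The data given by a family of codes. -/
noncomputable def Data.ofCode [Finite A] (code : (Fin n → A) → ZMod m → ToPartrec.Code)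
    (letter : ZMod m → A) : Data A n m :=
  letI := Fintype.ofFinite (Fin n → A)
  letI := ZMod.fintype m
  { code := code
    letter := letter
    S := Finset.univ.biUnion fun x : (Fin n → A) × ZMod m =>
      (codeSupp (code x.1 x.2) Cont'.halt).biUnion fun l => TM2.stmts₁ (prog l)
    start_mem := by
      intro a i
      simp only [Finset.mem_biUnion, Finset.mem_univ, true_and]
      exact ⟨(a, i), _, codeSupp_self _ _ (trStmts₁_self _), TM2.stmts₁_self⟩
    stmts_subset := by
      intro x hx y hy
      simp only [Finset.mem_biUnion, Finset.mem_univ, true_and] at hx ⊢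
      obtain ⟨c, l, hl, hx⟩ := hx
      exact ⟨c, l, hl, TM2.stmts₁_trans hx hy⟩
    goto_mem := by
      intro f hx v
      simp only [Finset.mem_biUnion, Finset.mem_univ, true_and] at hx ⊢
      obtain ⟨c, l, hl, hx⟩ := hx
      -- `codeSupp` is closed under jumps, and a substatement inherits this from the statement that
      -- contains it.
      have h := TM2.stmts₁_supportsStmt_mono hx
        (codeSupp_supports (Finset.Subset.refl (codeSupp (code c.1 c.2) Cont'.halt)) l hl)
      exact ⟨c, f v, h v, TM2.stmts₁_self⟩ }

/-- Binary numbers are stored with the least significant bit on top, so the parity is visible at the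
head. The number `0` has no bits and shows the separator instead. -/
theorem head?_trNum (m : Num) (l : List Γ') :
    (trNum m ++ Γ'.cons :: l).head? = some Γ'.bit1 ↔ (m : ℕ) % 2 = 1 := by
  rcases m with _ | m
  · simp [trNum]
  · rcases m with _ | m | m
    · simp [trNum, trPosNum]
    · simp only [trNum, trPosNum, List.cons_append, List.head?_cons, Num.cast_pos,
        PosNum.cast_bit1, true_iff]
      omega
    · simp only [trNum, trPosNum, List.cons_append, List.head?_cons, Num.cast_pos,
        PosNum.cast_bit0]
      constructor
      · intro h; simp at h
      · omega

theorem head?_trList (v : List ℕ) : (trList v).head? = some Γ'.bit1 ↔ v.headI % 2 = 1 := by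
  cases v with
  | nil => simp
  | cons a v =>
    rw [trList, trNat, head?_trNum, List.headI_cons]
    simp

/-- Precomposition with `head` makes the code depend on the first entry only and treat the empty
list, which is what the blank tapes carry at the start, as the number `0`. -/
theorem exists_code_of_primrec {f : ℕ → ℕ} (hf : Primrec f) :
    ∃ c : ToPartrec.Code, ∀ v, c.eval v = pure [f v.headI] := by
  obtain ⟨c, hc⟩ := ToPartrec.Code.exists_code
    (Nat.Partrec'.part_iff₁.2 (show Partrec (fun a => Part.some (f a)) from hf.to_comp.partrec))
  refine ⟨c.comp ToPartrec.Code.head, fun v => ?_⟩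
  have h : c.eval [v.headI] = pure [f v.headI] :=
    (hc (v.headI ::ᵥ List.Vector.nil)).trans (Part.map_some _ _)
  simp only [ToPartrec.Code.comp_eval, ToPartrec.Code.head_eval]
  exact (Part.bind_some _ _).trans h

/-! ## The transducer given by a primitive recursive function on finite words -/

variable [Primcodable A] [DecidableEq A] (φ : List (Fin n → A) → List A) (letter : ZMod m → A)

/-- The number of a pair of an input word and a number. -/
def pack (x : List (Fin n → A) × ℕ) : ℕ := @Encodable.encode _ Primcodable.toEncodable x

/-- The stored pair of the input word read so far and the number of letters written so far. -/
def unpack (s : ℕ) : List (Fin n → A) × ℕ :=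
  (@Encodable.decode _ Primcodable.toEncodable (s / 2)).getD ([], 0)

/-- The update of the stored number when the column `a` is read and the letter number `i` is
tested; the last bit says whether this letter is to be written. -/
def update (a : Fin n → A) (i : ZMod m) (s : ℕ) : ℕ :=
  let u := (unpack s).1 ++ [a]
  let b := if (φ u)[(unpack (n := n) (A := A) s).2]? = some (letter i) then 1 else 0
  2 * pack (u, (unpack (n := n) (A := A) s).2 + b) + b

theorem primrec_update (hφ : Primrec φ) (a : Fin n → A) (i : ZMod m) :
    Primrec (update φ letter a i) := by
  have hu : Primrec (unpack (n := n) (A := A)) :=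
    Primrec.option_getD.comp ((Primrec.decode (α := List (Fin n → A) × ℕ)).comp (Primrec.nat_div.comp .id (.const 2)))
      (.const ([], 0))
  have h₁ : Primrec fun s => (unpack (n := n) (A := A) s).1 ++ [a] :=
    Primrec.list_concat.comp (Primrec.fst.comp hu) (.const a)
  have h₂ : Primrec fun s => (unpack (n := n) (A := A) s).2 := Primrec.snd.comp hu
  have h₃ : Primrec fun s => if (φ ((unpack s).1 ++ [a]))[(unpack (n := n) (A := A) s).2]? =
      some (letter i) then 1 else 0 :=
    Primrec.ite (Primrec.eq.comp (Primrec.list_getElem?.comp (hφ.comp h₁) h₂) (.const _))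
      (.const 1) (.const 0)
  exact Primrec.nat_add.comp (Primrec.nat_double.comp (Primrec.encode.comp
    (Primrec.pair h₁ (Primrec.nat_add.comp h₂ h₃)))) h₃

/-- The number of letters written before round `N`, and the number (at most one) of letters that
are written in round `N`. -/
def counts : ℕ → ℕ × ℕ
  | 0 => (0, 0)
  | N + 1 => ((counts N).1 + (counts N).2,
      if (φ (columns p (N + 1)))[(counts N).1 + (counts N).2]? = some (letter ((N + 1 : ℕ) : ZMod m))
        then 1 else 0)

/-- The number stored before round `N`. -/
def stored (N : ℕ) : ℕ :=
  2 * pack (columns p N, (counts p φ letter N).1 + (counts p φ letter N).2) +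
    (counts p φ letter N).2

theorem counts_succ_snd (N : ℕ) : (counts p φ letter (N + 1)).2 = 1 ↔
    (φ (columns p (N + 1)))[(counts p φ letter N).1 + (counts p φ letter N).2]? =
      some (letter ((N + 1 : ℕ) : ZMod m)) := by
  simp only [counts]
  split_ifs with h
  · exact iff_of_true rfl h
  · exact iff_of_false (by simp) h

theorem counts_le (N : ℕ) : (counts p φ letter N).2 ≤ 1 := by
  cases N with
  | zero => simp [counts]
  | succ N => simp only [counts]; split_ifs <;> simp

theorem stored_mod (N : ℕ) : stored p φ letter N % 2 = (counts p φ letter N).2 := by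
  have := counts_le p φ letter N
  simp only [stored]
  omega

theorem unpack_stored (N : ℕ) : unpack (stored p φ letter N) =
    (columns p N, (counts p φ letter N).1 + (counts p φ letter N).2) := by
  have h : stored p φ letter N / 2 = pack
      (columns p N, (counts p φ letter N).1 + (counts p φ letter N).2) := by
    have := counts_le p φ letter N
    simp only [stored]
    omega
  rw [unpack, h, pack, @Encodable.encodek _ Primcodable.toEncodable, Option.getD_some]

theorem update_stored (N : ℕ) :
    update φ letter (fun j => p j N) ((N : ZMod m) + 1) (stored p φ letter N) =
      stored p φ letter (N + 1) := by
  simp only [update]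
  rw [unpack_stored]
  conv_rhs => rw [stored]
  simp only [counts]
  rw [Nat.cast_add, Nat.cast_one, columns_succ]

variable {p φ letter} {q : ℕ → A}

theorem letter_eq (hq : ∀ N, SeqPrefix (φ (columns p N)) q) {N : ℕ}
    (h : (counts p φ letter N).2 = 1) :
    letter (N : ZMod m) = q (counts p φ letter N).1 := by
  cases N with
  | zero => simp [counts] at h
  | succ N =>
    simp only [counts] at h ⊢
    split_ifs at h with h'
    exact hq _ _ _ h'

/-- If the number of written letters stopped at `K`, then from some round on nothing is written
although `φ` already yields more than `K` letters. But the rounds run through all residue classes,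
and in the one that offers the letter `q K` the test succeeds. -/
theorem exists_le_counts (hl : Function.Surjective letter)
    (hq : ∀ N, SeqPrefix (φ (columns p N)) q)
    (hlen : ∀ K, ∃ N₀, ∀ N ≥ N₀, K ≤ (φ (columns p N)).length) (K : ℕ) :
    ∃ N, K ≤ (counts p φ letter N).1 := by
  induction K with
  | zero => exact ⟨0, Nat.zero_le _⟩
  | succ K ih =>
    obtain ⟨N₁, hN₁⟩ := ih
    obtain ⟨N₀, hN₀⟩ := hlen (K + 1)
    by_contra! hcon
    have hmono : ∀ N, N₁ ≤ N → K ≤ (counts p φ letter N).1 := by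
      intro N hN
      induction N, hN using Nat.le_induction with
      | base => exact hN₁
      | succ N _ ih => simp only [counts]; omega
    have hval : ∀ N, N₁ ≤ N → (counts p φ letter N).1 = K ∧ (counts p φ letter N).2 = 0 := by
      intro N hN
      have h₁ := hmono N hN
      have h₂ := hcon N
      have h₃ := hcon (N + 1)
      simp only [counts] at h₃
      omega
    obtain ⟨i, hi⟩ := hl (q K)
    -- A late round for which `N + 1` lies in the residue class `i`.
    set N := (N₀ + N₁) * m + (i - 1).val with hN
    have hm : 0 < m := Nat.pos_of_ne_zero (NeZero.ne m)
    have hge : N₀ + N₁ ≤ N := (Nat.le_mul_of_pos_right _ hm).trans (Nat.le_add_right _ _)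
    have hcast : ((N + 1 : ℕ) : ZMod m) = i := by
      simp [hN]
    have h₁ := (hval (N + 1) (by omega)).2
    have h₂ := hval N (by omega)
    have hlt : K < (φ (columns p (N + 1))).length := hN₀ (N + 1) (by omega)
    have h₃ := (counts_succ_snd p φ letter N).2 (by
      rw [h₂.1, h₂.2, hcast, hi, Nat.add_zero K, List.getElem?_eq_getElem hlt, Option.some.injEq]
      exact hq _ _ _ (List.getElem?_eq_getElem hlt))
    omega

/-- Induction over the rounds with the stored number as invariant. The bound `N ≤ t` ensures that
the run goes on forever. -/
theorem Data.exists_run (D : Data A n m) (hφ : ∀ a i v, (D.code a i).eval v =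
      pure [update φ D.letter a i v.headI])
    (hq : ∀ N, SeqPrefix (φ (columns p N)) q) (N : ℕ) :
    ∃ t c, N ≤ t ∧ D.machine.run p t = some c ∧
      c.out = (List.range (counts p φ D.letter N).1).map q ∧
      ∃ v : List ℕ, v.headI = stored p φ D.letter N ∧
        c = D.cfg (N, none) (fun _ => N) (K'.elim (trList v) [] [] []) c.out := by
  induction N with
  | zero =>
    refine ⟨0, D.machine.init, le_rfl, rfl, rfl, [], ?_, ?_⟩
    -- The pair of the empty word and `0` has the code `0`, so the blank tapes represent the right
    -- number.
    · simp only [stored, columns_zero, counts]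
      rfl
    · rw [Nat.cast_zero]
      show D.raw _ _ _ _ = D.raw _ _ _ _
      congr 1
      funext r
      fin_cases r <;> rfl
  | succ N ih =>
    obtain ⟨t, c, hNt, hr, ho, v, hv, hc⟩ := ih
    rw [hc] at hr
    have hs := D.round_reaches p N (fun _ => N) c.out (hφ _ _ v)
    obtain ⟨t', htt, hr'⟩ := Type2Machine.run_add_of_transGen hs hr
    refine ⟨t', _, by omega, hr', ?_, [update φ D.letter (fun j => p j N) (N + 1) v.headI], ?_, ?_⟩
    · show c.out ++ _ = _
      have h := head?_trList v
      rw [hv, stored_mod] at h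
      by_cases hb : (counts p φ D.letter N).2 = 1
      · rw [if_pos (h.2 hb), ho, letter_eq hq hb]
        simp [counts, hb, List.range_succ]
      · have hb' := counts_le p φ D.letter N
        rw [if_neg fun h' => hb (h.1 h'), ho, counts]
        have : (counts p φ D.letter N).2 = 0 := by omega
        simp [this]
    · rw [hv]
      exact update_stored p φ D.letter N
    · rw [Nat.cast_add, Nat.cast_one]
      rfl

end CodeMachine

/-- If approximations of `q` can be computed from the prefixes of the input `p` by a primitive
recursive function, then a Type-2 machine computes `q` from `p`. -/
theorem exists_type2Machine_of_primrec {A : Type} [Finite A] [Nonempty A] [Primcodable A] {n : ℕ}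
    {φ : List (Fin n → A) → List A} (hφ : Primrec φ) :
    ∃ M : Type2Machine A n, ∀ p q, (∀ N, SeqPrefix (φ (columns p N)) q) →
      (∀ K, ∃ N₀, ∀ N ≥ N₀, K ≤ (φ (columns p N)).length) → q ∈ M.seqFun p := by
  classical
  have : NeZero (Nat.card A) := ⟨Nat.card_pos.ne'⟩
  -- The computed bit can only accept or reject a letter; hence the letters are offered cyclically,
  -- by residue class of the round.
  obtain ⟨letter, hl⟩ : ∃ f : ZMod (Nat.card A) → A, Function.Surjective f :=
    ⟨_, ((Finite.equivFinOfCardEq (Nat.card_zmod _)).trans (Finite.equivFin A).symm).surjective⟩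
  choose code hcode using fun (a : Fin n → A) i =>
    CodeMachine.exists_code_of_primrec (CodeMachine.primrec_update φ letter hφ a i)
  refine ⟨(CodeMachine.Data.ofCode code letter).machine, fun p q hq hlen => ?_⟩
  have hrun := (CodeMachine.Data.ofCode code letter).exists_run (p := p) hcode hq
  refine Type2Machine.mem_seqFun_of_frequently (fun N => ?_) fun K => ?_
  · obtain ⟨t, c, hNt, hr, ho, -⟩ := hrun N
    refine ⟨t, c, hNt, hr, seqPrefix_iff.2 ?_⟩
    rw [ho]
    simp
  · obtain ⟨N, hN⟩ := CodeMachine.exists_le_counts hl hq hlen K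
    obtain ⟨t, c, -, hr, ho, -⟩ := hrun N
    refine ⟨t, c, hr, ?_⟩
    rw [ho, List.length_map, List.length_range]
    exact hN

/-! ## Primitive recursive functions on finite types -/

/-- A finite type is primitively codable. -/
@[reducible] noncomputable def finitePrimcodable (α : Type*) [Finite α] : Primcodable α :=
  Primcodable.ofEquiv (Fin (Nat.card α)) (Finite.equivFin α)

theorem Primrec.finite_cases {ι α σ : Type*} [Finite ι] [Primcodable ι] [Primcodable α]
    [Primcodable σ] {f : ι → α → σ} (hf : ∀ i, Primrec (f i)) : Primrec₂ f := by
  have e := Finite.equivFin ι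
  have h : Primrec₂ fun k => f (e.symm k) := Primrec.fin_curry₁.2 fun k => hf _
  refine (h.comp (g := fun x : ι × α => e x.1) (h := fun x => x.2)
    ((Primrec.dom_finite e).comp .fst) .snd).of_eq fun x => ?_
  simp

theorem Primrec.fin_apply {n : ℕ} {α σ : Type*} [Primcodable α] [Primcodable σ]
    {f : α → Fin n → σ} (hf : Primrec f) (j : Fin n) : Primrec fun a => f a j :=
  Primrec.fin_app.comp hf (.const j)

theorem Primrec.fin_pi {n : ℕ} {α σ : Type*} [Primcodable α] [Primcodable σ]
    {f : α → Fin n → σ} (hf : ∀ j, Primrec fun a => f a j) : Primrec f :=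
  Primrec.fin_curry.2 (Primrec₂.swap (Primrec.fin_curry₁.2 hf))

/-! ## Simulating a Type-2 machine on finite prefixes of its input -/

namespace Type2Machine

open Turing

variable {A : Type} {n : ℕ} (M : Type2Machine A n)

/-- Configurations in which the tapes are given by a symbol and two words. -/
abbrev WordCfg : Type :=
  M.State × (Fin n → ℕ) × (Fin M.m → M.Work × List M.Work × List M.Work) × List A

/-- What a machine sees: its state, the input symbols (if available) and the work symbols. -/
abbrev View : Type := M.State × (Fin n → Option A) × (Fin M.m → M.Work)

variable {M}

/-- What the machine sees if only the prefixes `ws` of the input are available. -/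
def WordCfg.view (ws : Fin n → List A) (c : M.WordCfg) : M.View :=
  (c.1, fun j => (ws j)[c.2.1 j]?, fun r => (c.2.2.1 r).1)

/-- The action taken, if all input symbols are available and the machine does not halt. -/
def View.action (κ : M.View) : Option (Type2Action A M.State M.Work n M.m) :=
  if h : ∀ j, (κ.2.1 j).isSome then M.trans κ.1 (fun j => (κ.2.1 j).get (h j)) κ.2.2 else none

/-- Writing and moving on a tape given by words. -/
def tapeAct {W : Type} [Inhabited W] (x : W × Option Dir) (T : W × List W × List W) :
    W × List W × List W :=
  if x.2 = none then (x.1, T.2)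
  else if x.2 = some Dir.left then (T.2.1.headI, T.2.1.tail, x.1 :: T.2.2)
  else (T.2.2.headI, x.1 :: T.2.1, T.2.2.tail)

/-- A step of the simulation; nothing changes if the machine halts or if an input symbol is not
available. -/
def WordCfg.step (ws : Fin n → List A) (c : M.WordCfg) : M.WordCfg :=
  let a := (c.view ws).action
  (a.elim c.1 fun a => a.next,
    fun j => c.2.1 j + a.elim 0 fun a => (a.advance j).toNat,
    fun r => tapeAct (a.elim ((c.2.2.1 r).1, none) fun a => a.work r) (c.2.2.1 r),
    c.2.2.2 ++ a.elim [] fun a => a.emit.toList)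

variable (M) in
/-- The configuration after `N` steps of the simulation. -/
def wordRun (N : ℕ) (ws : Fin n → List A) : M.WordCfg :=
  (WordCfg.step ws)^[N] (M.start, fun _ => 0, fun _ => (default, [], []), [])

/-- The configuration represented by a configuration on words. -/
def WordCfg.toCfg (c : M.WordCfg) : M.Cfg where
  state := c.1
  pos := c.2.1
  work r := ⟨(c.2.2.1 r).1, ListBlank.mk (c.2.2.1 r).2.1, ListBlank.mk (c.2.2.1 r).2.2⟩
  out := c.2.2.2

theorem wordRun_succ (N : ℕ) (ws : Fin n → List A) :
    M.wordRun (N + 1) ws = (M.wordRun N ws).step ws :=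
  Function.iterate_succ_apply' _ _ _

theorem step_of_action_eq_none {ws : Fin n → List A} {c : M.WordCfg}
    (h : (c.view ws).action = none) : c.step ws = c := by
  simp [WordCfg.step, h, tapeAct]

theorem toCfg_step {ws : Fin n → List A} {c : M.WordCfg} {a : Type2Action A M.State M.Work n M.m}
    (h : (c.view ws).action = some a) : (c.step ws).toCfg = M.act a c.toCfg := by
  simp only [WordCfg.step, h, Option.elim_some, WordCfg.toCfg, act]
  congr 1
  · funext j
    cases a.advance j <;> simp
  · funext r
    rcases hd : (a.work r).2 with _ | d
    · simp [tapeAct, hd, Tape.write]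
    · cases d <;> simp [tapeAct, hd, Tape.write, Tape.move, ListBlank.head_mk, ListBlank.tail_mk,
        ListBlank.cons_mk]

/-- The action is `none` either because the machine halts or because an input symbol is missing.
Under `h` the second cause is excluded, so simulation and machine agree even about halting. -/
theorem step_eq_of_action {p : Fin n → ℕ → A} {ws : Fin n → List A}
    (hws : ∀ j, SeqPrefix (ws j) (p j)) {c : M.WordCfg}
    (h : ∀ j, ((c.view ws).2.1 j).isSome) :
    M.step p c.toCfg = (c.view ws).action.map fun a => M.act a c.toCfg := by
  simp only [View.action, dif_pos h]
  have e : (fun j => ((c.view ws).2.1 j).get (h j)) = fun j => p j (c.2.1 j) := by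
    funext j
    exact hws j (c.2.1 j) _ (Option.some_get (h j)).symm
  rw [e]
  rfl

theorem isSome_of_action {κ : M.View} {a : Type2Action A M.State M.Work n M.m}
    (h : κ.action = some a) (j : Fin n) : (κ.2.1 j).isSome := by
  unfold View.action at h
  split_ifs at h with h'
  exact h' j

/-- The simulation either makes a genuine step or stalls, so it stays on the actual run however
short the prefixes are. -/
theorem exists_run_wordRun {p : Fin n → ℕ → A} {ws : Fin n → List A}
    (hws : ∀ j, SeqPrefix (ws j) (p j)) (N : ℕ) :
    ∃ t, M.run p t = some (M.wordRun N ws).toCfg := by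
  induction N with
  | zero => exact ⟨0, rfl⟩
  | succ N ih =>
    obtain ⟨t, ht⟩ := ih
    rw [wordRun_succ]
    rcases ha : ((M.wordRun N ws).view ws).action with _ | a
    · exact ⟨t, by rw [step_of_action_eq_none ha, ht]⟩
    · refine ⟨t + 1, ?_⟩
      rw [run, ht, Option.bind_some, step_eq_of_action hws (isSome_of_action ha), ha,
        toCfg_step ha, Option.map_some]

theorem pos_le_of_run {p : Fin n → ℕ → A} {t : ℕ} {c : M.Cfg} (h : M.run p t = some c)
    (j : Fin n) : c.pos j ≤ t := by
  induction t generalizing c with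
  | zero =>
    obtain rfl : M.init = c := by simpa [run] using h
    exact le_rfl
  | succ t ih =>
    simp only [run, step, Option.bind_eq_some_iff, Option.map_eq_some_iff] at h
    obtain ⟨d, hd, a, _, rfl⟩ := h
    have := ih hd
    simp only [act]
    split_ifs <;> omega

theorem isSome_view {ws : Fin n → List A} {c : M.WordCfg} (h : ∀ j, c.toCfg.pos j < (ws j).length)
    (j : Fin n) : ((c.view ws).2.1 j).isSome := by
  have := h j
  simpa [WordCfg.view, WordCfg.toCfg] using this

/-- In `T` steps only the first `T` symbols of each input are scanned, so prefixes of this length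
never make the simulation stall. -/
theorem toCfg_wordRun {p : Fin n → ℕ → A} {ws : Fin n → List A}
    (hws : ∀ j, SeqPrefix (ws j) (p j)) {T : ℕ} (hT : ∀ j, T ≤ (ws j).length) {c : M.Cfg}
    (h : M.run p T = some c) : (M.wordRun T ws).toCfg = c := by
  induction T generalizing c with
  | zero =>
    obtain rfl : M.init = c := by simpa [run] using h
    rfl
  | succ T ih =>
    simp only [run, Option.bind_eq_some_iff] at h
    obtain ⟨d, hd, hs⟩ := h
    have hd' := ih (fun j => (Nat.le_succ T).trans (hT j)) hd
    have hv : ∀ j, (((M.wordRun T ws).view ws).2.1 j).isSome := isSome_view fun j => by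
      rw [hd']
      exact (pos_le_of_run hd j).trans_lt (hT j)
    rw [← hd', step_eq_of_action hws hv, Option.map_eq_some_iff] at hs
    obtain ⟨a, ha, rfl⟩ := hs
    rw [wordRun_succ, toCfg_step ha]

theorem out_length_mono {ws : Fin n → List A} {N N' : ℕ} (h : N ≤ N') :
    (M.wordRun N ws).2.2.2.length ≤ (M.wordRun N' ws).2.2.2.length := by
  induction N', h using Nat.le_induction with
  | base => exact le_rfl
  | succ N' _ ih =>
    rw [wordRun_succ]
    refine ih.trans ?_
    simp [WordCfg.step]

theorem wordRun_eq_of_action_eq_none {ws : Fin n → List A} {N N' : ℕ} (h : N ≤ N')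
    (ha : ((M.wordRun N ws).view ws).action = none) : M.wordRun N' ws = M.wordRun N ws := by
  induction N', h using Nat.le_induction with
  | base => rfl
  | succ N' _ ih => rw [wordRun_succ, ih, step_of_action_eq_none ha]

section Primrec

variable [Primcodable A] [Primcodable M.State] [Primcodable M.Work]

theorem primrec_tapeAct {W : Type} [Inhabited W] [Primcodable W] [Primcodable (Option Dir)]
    {α : Type*} [Primcodable α] {x : α → W × Option Dir} {T : α → W × List W × List W}
    (hx : Primrec x) (hT : Primrec T) : Primrec fun a => tapeAct (x a) (T a) := by
  have hx₁ := Primrec.fst.comp hx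
  have hx₂ := Primrec.snd.comp hx
  have hL := Primrec.fst.comp (Primrec.snd.comp hT)
  have hR := Primrec.snd.comp (Primrec.snd.comp hT)
  classical
  exact (Primrec.ite (Primrec.eq.comp hx₂ (.const none))
    (.pair hx₁ (Primrec.snd.comp hT))
    (Primrec.ite (Primrec.eq.comp hx₂ (.const (some Dir.left)))
      (.pair (Primrec.list_headI.comp hL)
        (.pair (Primrec.list_tail.comp hL) (Primrec.list_cons.comp hx₁ hR)))
      (.pair (Primrec.list_headI.comp hR)
        (.pair (Primrec.list_cons.comp hx₁ hL) (Primrec.list_tail.comp hR))))).of_eq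
    fun a => by simp only [tapeAct]

theorem primrec_view {α : Type*} [Primcodable α] {ws : α → Fin n → List A} {c : α → M.WordCfg}
    (hw : Primrec ws) (hc : Primrec c) : Primrec fun a => (c a).view (ws a) := by
  have h₂ := Primrec.fst.comp (Primrec.snd.comp hc)
  have h₃ := Primrec.fst.comp (Primrec.snd.comp (Primrec.snd.comp hc))
  refine .pair (Primrec.fst.comp hc) (.pair (.fin_pi fun j => ?_) (.fin_pi fun r => ?_))
  · exact Primrec.list_getElem?.comp (Primrec.fin_apply hw j) (Primrec.fin_apply h₂ j)
  · exact Primrec.fst.comp (Primrec.fin_apply h₃ r)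

variable [Finite A]

/-- The step depends on the transition function only through the `View`, which ranges over a finite
type, where every function is primitive recursive. What remains is bookkeeping with words and
positions. -/
theorem primrec_wordStep {α : Type*} [Primcodable α] {ws : α → Fin n → List A}
    {c : α → M.WordCfg} (hw : Primrec ws) (hc : Primrec c) :
    Primrec fun a => (c a).step (ws a) := by
  have := M.stateFinite
  have := M.workFinite
  have : Finite Dir := Finite.of_injective (fun d => decide (d = Dir.left)) (by
    intro a b; cases a <;> cases b <;> simp)
  let : Primcodable Dir := finitePrimcodable Dir
  have hv := primrec_view hw hc
  have h₂ := Primrec.fst.comp (Primrec.snd.comp hc)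
  have h₃ := Primrec.fst.comp (Primrec.snd.comp (Primrec.snd.comp hc))
  have h₄ := Primrec.snd.comp (Primrec.snd.comp (Primrec.snd.comp hc))
  refine .pair ?_ (.pair (.fin_pi fun j => ?_) (.pair (.fin_pi fun r => ?_) ?_))
  · exact (Primrec.dom_finite fun κ : M.View => κ.action.elim κ.1 fun a => a.next).comp hv
  · exact Primrec.nat_add.comp (Primrec.fin_apply h₂ j)
      ((Primrec.dom_finite fun κ : M.View => κ.action.elim 0 fun a => (a.advance j).toNat).comp hv)
  · exact primrec_tapeAct ((Primrec.dom_finite fun κ : M.View =>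
      κ.action.elim (κ.2.2 r, none) fun a => a.work r).comp hv) (Primrec.fin_apply h₃ r)
  · exact Primrec.list_append.comp h₄
      ((Primrec.dom_finite fun κ : M.View => κ.action.elim [] fun a => a.emit.toList).comp hv)

theorem primrec_wordRun : Primrec₂ M.wordRun :=
  Primrec.nat_iterate (h := fun (x : ℕ × (Fin n → List A)) c => WordCfg.step x.2 c)
    Primrec.fst (.const _) (primrec_wordStep (Primrec.snd.comp .fst) .snd)

end Primrec

variable (M) [Primcodable A] [Finite A]

/-- Sequences computed by a Type-2 machine can be approximated by a primitive recursive function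
of prefixes of the input and a number of steps. -/
theorem exists_primrec_seqFun : ∃ Φ : ℕ → (Fin n → List A) → List A, Primrec₂ Φ ∧
    ∀ p, ∀ q ∈ M.seqFun p,
      (∀ N ws, (∀ j, SeqPrefix (ws j) (p j)) → SeqPrefix (Φ N ws) q) ∧
      ∀ K, ∃ T, ∀ N ws, T ≤ N → (∀ j, SeqPrefix (ws j) (p j)) → (∀ j, T ≤ (ws j).length) →
        K ≤ (Φ N ws).length := by
  have := M.stateFinite
  have := M.workFinite
  let := finitePrimcodable M.State
  let := finitePrimcodable M.Work
  refine ⟨fun N ws => (M.wordRun N ws).2.2.2, ?_, fun p q hq => ⟨fun N ws hws => ?_, fun K => ?_⟩⟩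
  · exact Primrec.snd.comp (Primrec.snd.comp (Primrec.snd.comp primrec_wordRun))
  · obtain ⟨t, ht⟩ := exists_run_wordRun (M := M) hws N
    obtain ⟨c, hc, ho⟩ := hq.1 t
    obtain rfl : (M.wordRun N ws).toCfg = c := by simpa [ht] using hc
    exact seqPrefix_iff.2 ho
  · obtain ⟨T, c, hc, hK⟩ := hq.2 K
    refine ⟨T, fun N ws hN hws hT => ?_⟩
    have h := toCfg_wordRun hws hT hc
    refine le_trans ?_ (out_length_mono hN)
    rw [← h] at hK
    exact hK

/-- Words computed by a Type-2 machine can be approximated by a primitive recursive function of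
prefixes of the input and a number of steps. -/
theorem exists_primrec_wordFun : ∃ Ψ : ℕ → (Fin n → List A) → Option (List A), Primrec₂ Ψ ∧
    ∀ p, ∀ w ∈ M.wordFun p,
      (∀ N ws, (∀ j, SeqPrefix (ws j) (p j)) → ∀ w' ∈ Ψ N ws, w' = w) ∧
      ∃ T, ∀ N ws, T ≤ N → (∀ j, SeqPrefix (ws j) (p j)) → (∀ j, T ≤ (ws j).length) →
        Ψ N ws = some w := by
  classical
  have := M.stateFinite
  have := M.workFinite
  let := finitePrimcodable M.State
  let := finitePrimcodable M.Work
  -- Availability of all scanned symbols separates halting from waiting for input.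
  let halted : M.View → Bool := fun κ => decide ((∀ j, (κ.2.1 j).isSome) ∧ κ.action = none)
  refine ⟨fun N ws => if halted ((M.wordRun N ws).view ws) = true then
    some (M.wordRun N ws).2.2.2 else none, ?_, fun p w hw => ⟨fun N ws hws w' hw' => ?_, ?_⟩⟩
  · refine Primrec.ite (Primrec.eq.comp ((Primrec.dom_finite halted).comp
      (primrec_view .snd primrec_wordRun)) (.const true))
      (Primrec.option_some.comp (Primrec.snd.comp (Primrec.snd.comp (Primrec.snd.comp
        primrec_wordRun)))) (.const none)
  · simp only [Option.mem_def] at hw'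
    split_ifs at hw' with hh
    obtain ⟨h₁, h₂⟩ := of_decide_eq_true hh
    obtain ⟨t, ht⟩ := exists_run_wordRun (M := M) hws N
    refine wordFun_unique ⟨t, _, ht, ?_, Option.some.inj hw'⟩ hw
    rw [step_eq_of_action hws h₁, h₂, Option.map_none]
  · obtain ⟨t, c, hc, hs, rfl⟩ := hw
    -- After `t` steps a head may stand on cell `t`, and this symbol is needed to see that the
    -- machine halts.
    refine ⟨t + 1, fun N ws hN hws hT => ?_⟩
    have h := toCfg_wordRun hws (fun j => (Nat.le_succ t).trans (hT j)) hc
    have h₁ : ∀ j, (((M.wordRun t ws).view ws).2.1 j).isSome := isSome_view fun j => by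
      rw [h]
      exact (pos_le_of_run hc j).trans_lt (hT j)
    have h₂ : ((M.wordRun t ws).view ws).action = none := by
      rw [← h, step_eq_of_action hws h₁] at hs
      simpa using hs
    dsimp only
    rw [wordRun_eq_of_action_eq_none ((Nat.le_succ t).trans hN) h₂,
      if_pos (decide_eq_true ⟨h₁, h₂⟩), ← h]
    rfl

end Type2Machine

/-! ### Primitive recursive head movements -/

theorem Primrec.int_add_one : Primrec fun z : ℤ => z + 1 := by
  -- On codes: `n` has the code `2 * n` and `-(n + 1)` the code `2 * n + 1`. The successor raises
  -- even codes by `2`, lowers odd ones by `2`, and sends `1`, the code of `-1`, to `0`.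
  have h : Primrec fun e : ℕ => if e = 1 then 0 else if e % 2 = 0 then e + 2 else e - 2 :=
    Primrec.ite (Primrec.eq.comp .id (.const 1)) (.const 0)
      (Primrec.ite (Primrec.eq.comp (Primrec.nat_mod.comp .id (.const 2)) (.const 0))
        (Primrec.nat_add.comp .id (.const 2)) (Primrec.nat_sub.comp .id (.const 2)))
  refine Primrec.encode_iff.1 ((h.comp Primrec.encode).of_eq fun z => ?_)
  have e₁ : ∀ n : ℕ, Encodable.encode (Int.ofNat n) = 2 * n := fun _ => rfl
  have e₂ : ∀ n : ℕ, Encodable.encode (Int.negSucc n) = 2 * n + 1 := fun _ => rfl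
  rcases z with n | n
  · rw [show Int.ofNat n + 1 = Int.ofNat (n + 1) from rfl, e₁, e₁]
    rw [if_neg (by omega), if_pos (by omega)]
    omega
  · rcases n with _ | n
    · rfl
    · rw [show Int.negSucc (n + 1) + 1 = Int.negSucc n from rfl, e₂, e₂]
      rw [if_neg (by omega), if_neg (by omega)]
      omega

theorem Primrec.int_sub_one : Primrec fun z : ℤ => z - 1 := by
  have h' : Primrec fun e : ℕ => if e = 0 then 1 else if e % 2 = 0 then e - 2 else e + 2 :=
    Primrec.ite (Primrec.eq.comp .id (.const 0)) (.const 1)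
      (Primrec.ite (Primrec.eq.comp (Primrec.nat_mod.comp .id (.const 2)) (.const 0))
        (Primrec.nat_sub.comp .id (.const 2)) (Primrec.nat_add.comp .id (.const 2)))
  refine Primrec.encode_iff.1 ((h'.comp Primrec.encode).of_eq fun z => ?_)
  have e₁ : ∀ n : ℕ, Encodable.encode (Int.ofNat n) = 2 * n := fun _ => rfl
  have e₂ : ∀ n : ℕ, Encodable.encode (Int.negSucc n) = 2 * n + 1 := fun _ => rfl
  rcases z with n | n
  · rcases n with _ | n
    · rfl
    · rw [show Int.ofNat (n + 1) - 1 = Int.ofNat n by simp, e₁, e₁]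
      rw [if_neg (by omega), if_pos (by omega)]
      omega
  · rw [show Int.negSucc n - 1 = Int.negSucc (n + 1) from rfl, e₂, e₂]
    rw [if_neg (by omega), if_neg (by omega)]
    omega

theorem Primrec.fin_update {n : ℕ} {α σ : Type*} [Primcodable α] [Primcodable σ]
    {f : α → Fin n → σ} {g : α → σ} (hf : Primrec f) (hg : Primrec g) (i : Fin n) :
    Primrec fun a => Function.update (f a) i (g a) := by
  refine .fin_pi fun j => ?_
  by_cases h : j = i
  · subst h
    simpa using hg
  · simpa [Function.update_of_ne h] using Primrec.fin_apply hf j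

/-! ## Approximating generalized Turing machines on infinite sequences -/

namespace GTM

variable {A : Type} {F : GTMFrame}

/-- Configurations approximating configurations whose tapes carry infinite sequences: label,
head positions, and the list of all cells that have been written, the most recent first; the
cells contain finite words instead of infinite sequences. -/
abbrev LogConf (A : Type) (F : GTMFrame) : Type :=
  F.Label × (Fin (F.L + 1) → ℤ) × List ((Fin (F.L + 1) × ℤ) × (List A ⊕ F.Γ))

namespace LogConf

/-- The content of a cell. -/
def read (d : LogConf A F) (i : Fin (F.L + 1)) (m : ℤ) : List A ⊕ F.Γ :=
  (@List.lookup _ _ instBEqOfDecidableEq (i, m) d.2.2).getD (Sum.inr F.blank)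

/-- The content of the scanned cell. -/
def scan (d : LogConf A F) (i : Fin (F.L + 1)) : List A ⊕ F.Γ := d.read i (d.2.1 i)

/-- Write under the head of tape `i` and go to the label `l`. -/
def write (d : LogConf A F) (i : Fin (F.L + 1)) (x : List A ⊕ F.Γ) (l : F.Label) : LogConf A F :=
  (l, d.2.1, ((i, d.2.1 i), x) :: d.2.2)

theorem read_write (d : LogConf A F) (i j : Fin (F.L + 1)) (m : ℤ) (x : List A ⊕ F.Γ)
    (l : F.Label) : (d.write i x l).read j m = if j = i ∧ m = d.2.1 i then x else d.read j m := by
  have e : (@List.lookup _ _ instBEqOfDecidableEq (j, m) (d.write i x l).2.2) =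
      if (j, m) = (i, d.2.1 i) then some x
      else @List.lookup _ _ instBEqOfDecidableEq (j, m) d.2.2 := by
    refine (@List.lookup_cons _ _ _ _ _ instBEqOfDecidableEq _).trans ?_
    show (match decide ((j, m) = (i, d.2.1 i)) with | true => _ | false => _) = _
    split_ifs with h
    · rw [decide_eq_true h]
    · rw [decide_eq_false h]
  simp only [read, e, Prod.mk.injEq]
  split_ifs <;> rfl

end LogConf

/-- The cell content `x` approximates the cell content `y`, up to at least `K` symbols. -/
def CellApprox {A Γ : Type} (K : ℕ) : List A ⊕ Γ → (ℕ → A) ⊕ Γ → Prop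
  | .inl w, .inl q => SeqPrefix w q ∧ K ≤ w.length
  | .inr a, .inr b => a = b
  | _, _ => False

theorem CellApprox.mono {A Γ : Type} {K K' : ℕ} {x : List A ⊕ Γ} {y : (ℕ → A) ⊕ Γ}
    (h : CellApprox K x y) (hK : K' ≤ K) : CellApprox K' x y := by
  rcases x with x | x <;> rcases y with y | y <;> simp only [CellApprox] at h ⊢
  · exact ⟨h.1, hK.trans h.2⟩
  · exact h

theorem CellApprox.eq_inr_iff {A Γ : Type} {K : ℕ} {x : List A ⊕ Γ} {y : (ℕ → A) ⊕ Γ}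
    (h : CellApprox K x y) (a : Γ) : x = .inr a ↔ y = .inr a := by
  rcases x with x | x <;> rcases y with y | y <;> simp_all [CellApprox]

/-- The configuration `d` approximates the configuration `c`, up to at least `K` symbols in
every cell that contains an infinite sequence. -/
def Approx (K : ℕ) (d : LogConf A F) (c : Conf F fun _ => ℕ → A) : Prop :=
  d.1 = c.label ∧ d.2.1 = c.head ∧ ∀ i m, CellApprox K (d.read i m) (c.tape i m)

theorem Approx.mono {K K' : ℕ} {d : LogConf A F} {c : Conf F fun _ => ℕ → A}
    (h : Approx K d c) (hK : K' ≤ K) : Approx K' d c :=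
  ⟨h.1, h.2.1, fun i m => (h.2.2 i m).mono hK⟩

theorem Approx.scan {K : ℕ} {d : LogConf A F} {c : Conf F fun _ => ℕ → A}
    (h : Approx K d c) (i : Fin (F.L + 1)) : CellApprox K (d.scan i) (c.scan i) := by
  simp only [LogConf.scan, Conf.scan, h.2.1]
  exact h.2.2 _ _

theorem Approx.goto {K : ℕ} {d : LogConf A F} {c : Conf F fun _ => ℕ → A}
    (h : Approx K d c) (l : F.Label) : Approx K (l, d.2) (c.goto l) :=
  ⟨rfl, h.2.1, h.2.2⟩

theorem Approx.setHead {K : ℕ} {d : LogConf A F} {c : Conf F fun _ => ℕ → A}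
    (h : Approx K d c) (l : F.Label) (i : Fin (F.L + 1)) {m m' : ℤ} (hm : m = m') :
    Approx K (l, Function.update d.2.1 i m, d.2.2) ((c.setHead i m').goto l) :=
  ⟨rfl, by subst hm; exact congrArg (fun f => Function.update f i m) h.2.1, h.2.2⟩

theorem Approx.setCell {K : ℕ} {d : LogConf A F} {c : Conf F fun _ => ℕ → A}
    (h : Approx K d c) (l : F.Label) (i : Fin (F.L + 1)) {x : List A ⊕ F.Γ} {y : (ℕ → A) ⊕ F.Γ}
    (hxy : CellApprox K x y) : Approx K (d.write i x l) ((c.setCell i y).goto l) := by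
  refine ⟨rfl, h.2.1, fun j m => ?_⟩
  rw [LogConf.read_write, h.2.1]
  simp only [Conf.setCell, Conf.goto]
  by_cases hj : j = i
  · subst hj
    by_cases hm : m = c.head j
    · subst hm
      simpa using hxy
    · simpa [hm] using h.2.2 j m
  · simpa [hj] using h.2.2 j m

/-- The word in a cell, if there is one. -/
def cellWord {A Γ : Type*} : List A ⊕ Γ → Option (List A) := Sum.elim some fun _ => none

/-- The words scanned on the tapes `t j`, provided that each of these tapes scans a word. -/
def LogConf.words {n : ℕ} (d : LogConf A F) (t : Fin n → Fin (F.L + 1)) :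
    Option (Fin n → List A) :=
  if ∀ j, (cellWord (d.scan (t j))).isSome = true then
    some fun j => (cellWord (d.scan (t j))).getD [] else none

theorem Approx.words {K : ℕ} {d : LogConf A F} {c : Conf F fun _ => ℕ → A} (h : Approx K d c)
    {n : ℕ} {t : Fin n → Fin (F.L + 1)} {x : Fin n → ℕ → A} (hx : ∀ j, c.scan (t j) = .inl (x j)) :
    ∃ ws, d.words t = some ws ∧ ∀ j, SeqPrefix (ws j) (x j) ∧ K ≤ (ws j).length := by
  have hw : ∀ j, ∃ w, d.scan (t j) = .inl w ∧ SeqPrefix w (x j) ∧ K ≤ w.length := by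
    intro j
    have hj := h.scan (t j)
    rw [hx j] at hj
    rcases hd : d.scan (t j) with w | a <;> rw [hd] at hj
    · exact ⟨w, rfl, hj⟩
    · exact hj.elim
  choose ws h₁ h₂ using hw
  refine ⟨ws, ?_, h₂⟩
  simp [LogConf.words, cellWord, h₁]

section Primrec

theorem primrec_cellWord {Γ α : Type*} [Primcodable A] [Primcodable Γ] [Primcodable α]
    {x : α → List A ⊕ Γ} (hx : Primrec x) : Primrec fun a => cellWord (x a) :=
  (Primrec.sumCasesOn (g := fun _ w => some w) (h := fun _ _ => none) hx
    (Primrec.option_some.comp .snd) (.const none)).of_eq fun a => by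
      cases x a <;> rfl

variable [Primcodable A] [Primcodable F.Label] [Primcodable F.Γ]
  {α : Type*} [Primcodable α] {d : α → LogConf A F}

theorem primrec_scan (hd : Primrec d) (i : Fin (F.L + 1)) : Primrec fun a => (d a).scan i :=
  Primrec.option_getD.comp (Primrec.listLookup.comp
    (Primrec.pair (.const i) (Primrec.fin_apply (Primrec.fst.comp (Primrec.snd.comp hd)) i))
    (Primrec.snd.comp (Primrec.snd.comp hd))) (.const _)

theorem primrec_read (hd : Primrec d) (i : Fin (F.L + 1)) (m : ℤ) :
    Primrec fun a => (d a).read i m :=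
  Primrec.option_getD.comp (Primrec.listLookup.comp (.const (i, m))
    (Primrec.snd.comp (Primrec.snd.comp hd))) (.const _)

theorem primrec_write (hd : Primrec d) (i : Fin (F.L + 1)) {x : α → List A ⊕ F.Γ}
    (hx : Primrec x) (l : F.Label) : Primrec fun a => (d a).write i (x a) l :=
  .pair (.const l) (.pair (Primrec.fst.comp (Primrec.snd.comp hd)) (Primrec.list_cons.comp
    (Primrec.pair (Primrec.pair (.const i)
      (Primrec.fin_apply (Primrec.fst.comp (Primrec.snd.comp hd)) i)) hx)
    (Primrec.snd.comp (Primrec.snd.comp hd))))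

theorem primrec_words (hd : Primrec d) {n : ℕ} (t : Fin n → Fin (F.L + 1)) :
    Primrec fun a => (d a).words t := by
  classical
  have h : Primrec fun a => fun j => cellWord ((d a).scan (t j)) :=
    .fin_pi fun j => primrec_cellWord (primrec_scan hd (t j))
  have h₁ : Primrec fun a => fun j => (cellWord ((d a).scan (t j))).isSome :=
    .fin_pi fun j => Primrec.option_isSome.comp (Primrec.fin_apply h j)
  have h₂ : Primrec fun a => decide (∀ j, (cellWord ((d a).scan (t j))).isSome = true) :=
    (Primrec.dom_finite fun b : Fin n → Bool => decide (∀ j, b j = true)).comp h₁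
  exact Primrec.ite h₂.primrecPred (Primrec.option_some.comp (.fin_pi fun j =>
    Primrec.option_getD.comp (Primrec.fin_apply h j) (.const []))) (.const none)

end Primrec

/-- For statements that call no function: no known symbol is lost, so precision `K` before the step
suffices for precision `K` after it. -/
theorem approx_of_total {E : LogConf A F → LogConf A F} {c c' : Conf F fun _ => ℕ → A}
    (h : ∀ K d, Approx K d c → Approx K (E d) c') :
    (∀ (_ : ℕ) d, Approx 0 d c → ∀ d' ∈ some (E d), Approx 0 d' c') ∧
    ∀ K, ∃ T, ∀ N d, T ≤ N → Approx T d c → ∃ d', some (E d) = some d' ∧ Approx K d' c' := by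
  refine ⟨fun _ d hd d' hd' => ?_, fun K => ⟨K, fun _ d _ hd => ⟨_, rfl, h K d hd⟩⟩⟩
  obtain rfl := Option.some.inj hd'
  exact h 0 d hd

/-! ### Effects of single statements on approximations -/

variable [Alphabet A] [Primcodable A] [Primcodable F.Label] [Primcodable F.Γ]

/-- The effect of the statement `s` can be computed on approximations. -/
def StmtApprox (s : Stmt A F fun _ => ℕ → A) : Prop :=
  ∃ E : ℕ → LogConf A F → Option (LogConf A F), Primrec₂ E ∧ ∀ c c', Exec s c c' →
    (∀ N d, Approx 0 d c → ∀ d' ∈ E N d, Approx 0 d' c') ∧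
    ∀ K, ∃ T, ∀ N d, T ≤ N → Approx T d c → ∃ d', E N d = some d' ∧ Approx K d' c'

theorem stmtApprox_right (i : Fin (F.L + 1)) (l : F.Label) :
    StmtApprox (A := A) (.right i l) := by
  refine ⟨fun _ d => some (l, Function.update d.2.1 i (d.2.1 i + 1), d.2.2), ?_, ?_⟩
  · have h := Primrec.fst.comp (Primrec.snd.comp (Primrec.snd (α := ℕ) (β := LogConf A F)))
    exact Primrec.option_some.comp (.pair (.const l) (.pair (Primrec.fin_update h
      (Primrec.int_add_one.comp (Primrec.fin_apply h i)) i)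
      (Primrec.snd.comp (Primrec.snd.comp .snd))))
  · rintro c c' rfl
    exact approx_of_total fun K d hd => hd.setHead l i (by rw [hd.2.1])

theorem stmtApprox_left (i : Fin (F.L + 1)) (l : F.Label) :
    StmtApprox (A := A) (.left i l) := by
  refine ⟨fun _ d => some (l, Function.update d.2.1 i (d.2.1 i - 1), d.2.2), ?_, ?_⟩
  · have h := Primrec.fst.comp (Primrec.snd.comp (Primrec.snd (α := ℕ) (β := LogConf A F)))
    exact Primrec.option_some.comp (.pair (.const l) (.pair (Primrec.fin_update h
      (Primrec.int_sub_one.comp (Primrec.fin_apply h i)) i)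
      (Primrec.snd.comp (Primrec.snd.comp .snd))))
  · rintro c c' rfl
    exact approx_of_total fun K d hd => hd.setHead l i (by rw [hd.2.1])

theorem stmtApprox_write (i : Fin (F.L + 1)) (a : F.Γ) (l : F.Label) :
    StmtApprox (A := A) (.write i a l) := by
  refine ⟨fun _ d => some (d.write i (.inr a) l), ?_, ?_⟩
  · exact Primrec.option_some.comp (primrec_write .snd i (.const _) l)
  · rintro c c' rfl
    exact approx_of_total fun K d hd => hd.setCell l i rfl

theorem stmtApprox_ifSym (i : Fin (F.L + 1)) (a : F.Γ) (l l' : F.Label) :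
    StmtApprox (A := A) (.ifSym i a l l') := by
  classical
  refine ⟨fun _ d => some (if d.scan i = .inr a then l else l', d.2), ?_, ?_⟩
  · exact Primrec.option_some.comp (.pair (Primrec.ite (Primrec.eq.comp (primrec_scan .snd i)
      (.const _)) (.const l) (.const l')) (Primrec.snd.comp .snd))
  · rintro c c' (⟨h, rfl⟩ | ⟨h, rfl⟩)
    · refine approx_of_total fun K d hd => ?_
      rw [if_pos (((hd.scan i).eq_inr_iff a).2 h)]
      exact hd.goto l
    · refine approx_of_total fun K d hd => ?_
      rw [if_neg (mt ((hd.scan i).eq_inr_iff a).1 h)]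
      exact hd.goto l'

/-- The word assigned is the output of the Type-2 machine simulated for `N` steps on the known
prefixes. It is always correct, and long once `N` and the prefixes are. -/
theorem stmtApprox_assign [Finite A] (i : Fin (F.L + 1)) {n : ℕ} (t : Fin n → Fin (F.L + 1))
    (M : Type2Machine A n) (l : F.Label) :
    StmtApprox (A := A) (F := F) (.assign i t M.seqFun l) := by
  obtain ⟨Φ, hΦ, hM⟩ := M.exists_primrec_seqFun
  refine ⟨fun N d => (d.words t).map fun ws => d.write i (.inl (Φ N ws)) l, ?_, ?_⟩
  · exact Primrec.option_map (primrec_words .snd t) (primrec_write (Primrec.snd.comp .fst) i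
      (Primrec.sumInl.comp (hΦ.comp (Primrec.fst.comp .fst) .snd)) l)
  · rintro c c' ⟨x, hx, q, hq, rfl⟩
    obtain ⟨h₁, h₂⟩ := hM x q hq
    refine ⟨fun N d hd d' hd' => ?_, fun K => ?_⟩
    · obtain ⟨ws, hws, hp⟩ := hd.words hx
      simp only [hws, Option.map_some, Option.mem_def, Option.some.injEq] at hd'
      subst hd'
      exact hd.setCell l i ⟨h₁ N ws fun j => (hp j).1, Nat.zero_le _⟩
    · obtain ⟨T, hT⟩ := h₂ K
      -- `K` serves the cells that are not overwritten, `T` the new content.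
      refine ⟨max K T, fun N d hN hd => ?_⟩
      obtain ⟨ws, hws, hp⟩ := hd.words hx
      refine ⟨d.write i (.inl (Φ N ws)) l, by dsimp only; rw [hws, Option.map_some], ?_⟩
      exact (hd.mono (le_max_left _ _)).setCell l i ⟨h₁ N ws fun j => (hp j).1,
        hT N ws ((le_max_right _ _).trans hN) (fun j => (hp j).1)
          fun j => (le_max_right _ _).trans (hp j).2⟩

/-- The answer of a test is found after finitely many steps from finite prefixes; before that the
effect is undefined, but never wrong. -/
theorem stmtApprox_test [Finite A] {n : ℕ} (t : Fin n → Fin (F.L + 1)) (M : Type2Machine A n)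
    (f : MultiFun (Fin n → ℕ → A) (List A)) (hM : ∀ p, f p ⊆ M.wordFun p)
    (hf : f.IsPartialFun) (hf' : ∀ x, f x ⊆ {wordZero A, wordOne A}) (l l' : F.Label) :
    StmtApprox (A := A) (F := F) (.test t f hf hf' l l') := by
  classical
  obtain ⟨Ψ, hΨ, hM'⟩ := M.exists_primrec_wordFun
  refine ⟨fun N d => (d.words t).bind fun ws => (Ψ N ws).map fun w =>
    (if w = wordZero A then l else l', d.2), ?_, ?_⟩
  · exact Primrec.option_bind (primrec_words .snd t) (Primrec.option_map
      (hΨ.comp (Primrec.fst.comp .fst) .snd) (Primrec.pair (Primrec.ite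
        (Primrec.eq.comp .snd (.const _)) (.const l) (.const l'))
        (Primrec.snd.comp (Primrec.snd.comp (Primrec.fst.comp .fst)))))
  · have key : ∀ (c : Conf F fun _ => ℕ → A) (x : Fin n → ℕ → A) (w : List A),
        (∀ j, c.scan (t j) = .inl (x j)) → w ∈ f x →
        (∀ N d, Approx 0 d c → ∀ d' ∈ ((d.words t).bind fun ws => (Ψ N ws).map fun w =>
          (if w = wordZero A then l else l', d.2)),
          Approx 0 d' (c.goto (if w = wordZero A then l else l'))) ∧
        ∀ K, ∃ T, ∀ N d, T ≤ N → Approx T d c → ∃ d', ((d.words t).bind fun ws => (Ψ N ws).map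
          fun w => (if w = wordZero A then l else l', d.2)) = some d' ∧
          Approx K d' (c.goto (if w = wordZero A then l else l')) := by
      intro c x w hx hw
      obtain ⟨h₁, T, hT⟩ := hM' x w (hM x hw)
      refine ⟨fun N d hd d' hd' => ?_, fun K => ⟨max K T, fun N d hN hd => ?_⟩⟩
      · obtain ⟨ws, hws, hp⟩ := hd.words hx
        simp only [hws, Option.bind_some, Option.mem_def, Option.map_eq_some_iff] at hd'
        obtain ⟨w', hw', rfl⟩ := hd'
        rw [h₁ N ws (fun j => (hp j).1) w' hw']
        exact hd.goto _
      · obtain ⟨ws, hws, hp⟩ := hd.words hx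
        refine ⟨_, ?_, (hd.mono (le_max_left _ _)).goto _⟩
        rw [hws, Option.bind_some, hT N ws ((le_max_right _ _).trans hN) (fun j => (hp j).1)
          fun j => (le_max_right _ _).trans (hp j).2, Option.map_some]
    rintro c c' ⟨x, hx, (⟨hw, rfl⟩ | ⟨hw, rfl⟩)⟩
    · have := key c x _ hx hw
      rwa [if_pos rfl] at this
    · have := key c x _ hx hw
      rwa [if_neg (by
        simp only [wordOne, wordZero, List.cons.injEq, and_true]
        exact fun h => Alphabet.zero_ne_one h.symm)] at this

end GTM

namespace GTM

/-! ## Deterministic generalized Turing machines on infinite sequences -/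

section Deterministic

variable {A : Type} [Alphabet A] {F : GTMFrame} {X : Fin (F.L + 1) → Type u}

/-- A final configuration has no successor. -/
theorem not_step_of_final {M : GTM A F X} {c c' : Conf F X} (h : c.label = F.final) :
    ¬ M.Step c c' := fun ⟨h', _⟩ => h' h

theorem eq_of_reaches_final {M : GTM A F X} {c c' : Conf F X} (h : c.label = F.final)
    (hr : Relation.ReflTransGen M.Step c c') : c = c' := by
  rcases hr.cases_head with h' | ⟨d, hd, -⟩
  · exact h'
  · exact (not_step_of_final h hd).elim

/-- Two computations of a deterministic machine from one configuration are comparable, and none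
continues beyond a final configuration. -/
theorem reaches_final_of_rightUnique {M : GTM A F X} (hM : Relator.RightUnique M.Step)
    {c c' d : Conf F X} (hd : Relation.ReflTransGen M.Step c d) (h : d.label = F.final)
    (hc' : Relation.ReflTransGen M.Step c c') : Relation.ReflTransGen M.Step c' d := by
  rcases Relation.ReflTransGen.total_of_right_unique hM hc' hd with h' | h'
  · exact h'
  · rw [eq_of_reaches_final h h']

theorem isPartialFun_computes {M : GTM A F X} (hM : Relator.RightUnique M.Step) :
    M.computes.IsPartialFun := by
  rintro x y ⟨-, c, hc, hl, hy⟩ y' ⟨-, c', hc', hl', hy'⟩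
  obtain rfl := eq_of_reaches_final hl (reaches_final_of_rightUnique hM hc' hl' hc)
  exact Sum.inl.inj (hy.symm.trans hy')

end Deterministic

/-! ## Running a generalized Turing machine on approximations -/

section Run

variable {A : Type} {F : GTMFrame}

/-- The initial configuration for words approximating the inputs. -/
def initLog (ws : Fin F.k → List A) : LogConf A F :=
  (F.start, fun _ => 0, List.ofFn fun j => ((F.inTape j, 0), Sum.inl (ws j)))

theorem lookup_ofFn {α β : Type*} [DecidableEq α] {k : ℕ} {key : Fin k → α}
    (hkey : Function.Injective key) (val : Fin k → β) (j : Fin k) :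
    (List.ofFn fun j => (key j, val j)).lookup (key j) = some (val j) := by
  induction k with
  | zero => exact j.elim0
  | succ k ih =>
    rw [List.ofFn_succ, List.lookup_cons]
    refine j.cases ?_ fun j => ?_
    · simp
    · rw [beq_eq_false_iff_ne.2 fun h => Fin.succ_ne_zero j (hkey h)]
      exact ih (hkey.comp (Fin.succ_injective _)) (fun j => val j.succ) j

theorem inTape_injective : Function.Injective F.inTape := fun i j h => by
  simpa [GTMFrame.inTape] using h

theorem approx_initLog {K : ℕ} {ws : Fin F.k → List A} {x : Fin F.k → ℕ → A}
    (hws : ∀ j, SeqPrefix (ws j) (x j) ∧ K ≤ (ws j).length) :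
    Approx K (initLog ws) (initConf (X := fun _ => ℕ → A) x) := by
  have hnone : ∀ (i : Fin (F.L + 1)) (m : ℤ), (∀ j : Fin F.k, (i, m) ≠ (F.inTape j, 0)) →
      (initLog ws).read i m = .inr F.blank := by
    intro i m h
    rw [LogConf.read, (@List.lookup_eq_none_iff _ instBEqOfDecidableEq _ _ _).2]
    · rfl
    · intro y hy
      obtain ⟨j, rfl⟩ := List.mem_ofFn.1 hy
      simpa [bne] using h j
  refine ⟨rfl, rfl, fun i m => ?_⟩
  refine i.cases ?_ fun i => ?_
  · rw [hnone 0 m fun j h => Fin.succ_ne_zero _ (Prod.mk.inj h).1.symm]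
    rfl
  · show CellApprox K _ (if h : i.1 < F.k ∧ m = 0 then Sum.inl (x ⟨i.1, h.1⟩) else Sum.inr F.blank)
    split_ifs with h
    · obtain ⟨hi, rfl⟩ := h
      have e : i.succ = F.inTape ⟨i.1, hi⟩ := rfl
      have hinj : Function.Injective fun j => (F.inTape j, (0 : ℤ)) :=
        fun a b h => inTape_injective (congrArg Prod.fst h)
      have hl := lookup_ofFn hinj (fun j => (Sum.inl (ws j) : List A ⊕ F.Γ)) ⟨i.1, hi⟩
      have hr : (initLog ws).read i.succ 0 = .inl (ws ⟨i.1, hi⟩) := by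
        rw [LogConf.read, initLog, e]
        exact congrArg (fun o => Option.getD o (Sum.inr F.blank)) hl
      rw [hr]
      exact hws _
    · rw [hnone i.succ m]
      · rfl
      · rintro j hj
        obtain ⟨h₁, h₂⟩ := Prod.mk.inj hj
        refine h ⟨?_, h₂⟩
        rw [GTMFrame.inTape, Fin.succ_inj] at h₁
        rw [h₁]
        exact j.2

/-- The word in cell `0` of the output tape of a final configuration; the empty word in all other
cases. -/
noncomputable def LogConf.output (d : LogConf A F) : List A :=
  open scoped Classical in if d.1 = F.final then (cellWord (d.read 0 0)).getD [] else []

theorem primrec_output [Primcodable A] [Primcodable F.Label] [Primcodable F.Γ] :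
    Primrec (LogConf.output (A := A) (F := F)) := by
  classical
  exact Primrec.ite (Primrec.eq.comp .fst (.const _)) (Primrec.option_getD.comp
    (primrec_cellWord (primrec_read .id 0 0)) (.const [])) (.const [])

theorem primrec_initLog {α : Type*} [Primcodable α] [Primcodable A] [Primcodable F.Label]
    [Primcodable F.Γ] {ws : α → Fin F.k → List A} (hws : Primrec ws) :
    Primrec fun a => initLog (ws a) :=
  .pair (.const _) (.pair (.const _) (Primrec.list_ofFn fun j => .pair (.const _)
    (Primrec.sumInl.comp (Primrec.fin_apply hws j))))

end Run

variable {A : Type} [Alphabet A] {F : GTMFrame}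

/-- On input prefixes `u` the approximating machine is run for `u.length` statements, each with time
bound `u.length`. Since a non-final configuration yields no output, `φ u` is always a prefix of the
result; since the computation is finite, its length grows beyond every bound. -/
theorem isComputableSeqFun_computes [Primcodable A] [Primcodable F.Label] [Primcodable F.Γ]
    {M : GTM A F fun _ => ℕ → A} (hM : Relator.RightUnique M.Step)
    (hs : ∀ l, StmtApprox (M.stm l)) :
    IsComputableSeqFun (n := F.k) M.computes := by
  classical
  refine ⟨isPartialFun_computes hM, ?_⟩
  have : Finite A := Alphabet.finite
  have : Nonempty A := ⟨Alphabet.zero⟩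
  have := F.labelFinite
  choose E hE hEM using hs
  let G : F.Label → ℕ × LogConf A F → Option (LogConf A F) := fun l x =>
    if h : l ≠ F.final then E ⟨l, h⟩ x.1 x.2 else some x.2
  have hG : Primrec₂ G := Primrec.finite_cases fun l => by
    by_cases h : l ≠ F.final
    · simp only [G, dif_pos h]
      exact hE ⟨l, h⟩
    · simp only [G, dif_neg h]
      exact Primrec.option_some.comp Primrec.snd
  let run : ℕ → ℕ → (Fin F.k → List A) → Option (LogConf A F) := fun N t ws =>
    (fun o : Option (LogConf A F) => o.bind fun d => G d.1 (N, d))^[t] (some (initLog ws))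
  have hrun_succ : ∀ N t ws, run N (t + 1) ws = (run N t ws).bind fun d => G d.1 (N, d) :=
    fun N t ws => Function.iterate_succ_apply' _ _ _
  have hfinal : ∀ (d : LogConf A F) N, d.1 = F.final → G d.1 (N, d) = some d := by
    intro d N hd
    simp [G, hd]
  let words : List (Fin F.k → A) → Fin F.k → List A := fun u j => u.map fun a => a j
  have hwords : Primrec words := .fin_pi fun j => Primrec.list_map .id
    ((Primrec.fin_apply .id j).comp .snd)
  let φ : List (Fin F.k → A) → List A := fun u =>
    ((run u.length u.length (words u)).map LogConf.output).getD []
  have hφ : Primrec φ := by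
    have hr : Primrec fun u : List (Fin F.k → A) => run u.length u.length (words u) :=
      Primrec.nat_iterate Primrec.list_length (Primrec.option_some.comp (primrec_initLog hwords))
        (Primrec.option_bind .snd (hG.comp (Primrec.fst.comp .snd) (.pair
          (Primrec.list_length.comp (Primrec.fst.comp .fst)) .snd)))
    exact Primrec.option_getD.comp (Primrec.option_map hr (primrec_output.comp .snd)) (.const [])
  obtain ⟨T, hT⟩ := exists_type2Machine_of_primrec hφ
  refine ⟨T, fun p q hq => hT p q ?_ ?_⟩
  all_goals
    obtain ⟨-, cf, hcf, hl, hres⟩ := hq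
    have hwp : ∀ N j, SeqPrefix (words (columns p N) j) (p j) ∧
        N ≤ (words (columns p N) j).length := by
      intro N j
      refine ⟨seqPrefix_iff.2 ?_, by simp [words]⟩
      simp [words, columns]
  -- Soundness. The effects `E` are reliable only along steps that `M` can execute. Determinism
  -- provides these: every reachable configuration lies on the path to `cf`, hence is final or has a
  -- successor.
  · have sound : ∀ N t d, run N t (words (columns p N)) = some d →
        ∃ c, Relation.ReflTransGen M.Step (initConf p) c ∧ Approx 0 d c := by
      intro N t
      induction t with
      | zero =>
        rintro d ⟨⟩
        exact ⟨_, .refl, (approx_initLog (hwp N)).mono (Nat.zero_le _)⟩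
      | succ t ih =>
        intro d hd
        rw [hrun_succ, Option.bind_eq_some_iff] at hd
        obtain ⟨d₀, hd₀, hd⟩ := hd
        obtain ⟨c, hc, hdc⟩ := ih d₀ hd₀
        by_cases hfin : d₀.1 = F.final
        · rw [hfinal d₀ N hfin] at hd
          obtain rfl := Option.some.inj hd
          exact ⟨c, hc, hdc⟩
        · have hfc : c.label ≠ F.final := by rwa [← hdc.1]
          rcases (reaches_final_of_rightUnique hM hcf hl hc).cases_head with rfl | ⟨c', hc', -⟩
          · exact (hfc hl).elim
          · refine ⟨c', hc.tail hc', ?_⟩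
            obtain ⟨_, hex⟩ := hc'
            refine ((hEM _ _ _ hex).1 N d₀ hdc) d ?_
            obtain ⟨l₀, rest⟩ := d₀
            obtain rfl : l₀ = c.label := hdc.1
            simpa [G, hfc] using hd
    intro N
    simp only [φ, columns_length]
    rcases hd : run N N (words (columns p N)) with _ | d
    · exact seqPrefix_nil _
    · obtain ⟨c, hc, hdc⟩ := sound N N d hd
      simp only [Option.map_some, Option.getD_some, LogConf.output]
      split_ifs with hfin
      · rw [hdc.1] at hfin
        obtain rfl := eq_of_reaches_final hfin (reaches_final_of_rightUnique hM hcf hl hc)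
        have h := hdc.2.2 0 0
        rw [hres] at h
        rcases hr : d.read 0 0 with w | a <;> rw [hr] at h
        · exact h.1
        · exact h.elim
      · exact seqPrefix_nil _
  -- Convergence. The number `t` of steps is fixed before the precision `K`, which is passed back
  -- through these steps one at a time.
  · have converge : ∀ c, Relation.ReflTransGen M.Step (initConf p) c → ∃ t, ∀ K, ∃ T, ∀ N, T ≤ N →
        ∃ d, run N t (words (columns p N)) = some d ∧ Approx K d c := by
      intro c hc
      induction hc with
      | refl => exact ⟨0, fun K => ⟨K, fun N hN => ⟨_, rfl, (approx_initLog (hwp N)).mono hN⟩⟩⟩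
      | @tail c c' _ hs ih =>
        obtain ⟨t, ht⟩ := ih
        obtain ⟨hfc, hex⟩ := hs
        refine ⟨t + 1, fun K => ?_⟩
        obtain ⟨T₁, hT₁⟩ := (hEM _ _ _ hex).2 K
        obtain ⟨T₂, hT₂⟩ := ht T₁
        refine ⟨max T₁ T₂, fun N hN => ?_⟩
        obtain ⟨d, hd, hdc⟩ := hT₂ N ((le_max_right _ _).trans hN)
        obtain ⟨d', hd', hdc'⟩ := hT₁ N d ((le_max_left _ _).trans hN) hdc
        refine ⟨d', ?_, hdc'⟩
        rw [hrun_succ, hd, Option.bind_some, ← hd']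
        obtain ⟨l₀, rest⟩ := d
        obtain rfl : l₀ = c.label := hdc.1
        simp [G, hfc]
    obtain ⟨t, ht⟩ := converge cf hcf
    intro K
    obtain ⟨T, hT⟩ := ht K
    refine ⟨max T t, fun N hN => ?_⟩
    obtain ⟨d, hd, hdc⟩ := hT N ((le_max_left _ _).trans hN)
    have hfin : d.1 = F.final := hdc.1.trans hl
    have hN' : run N N (words (columns p N)) = some d := by
      -- Final configurations are fixed by `G`, so continuing up to `N` steps changes nothing.
      have h : ∀ s, t ≤ s → run N s (words (columns p N)) = some d := by
        intro s hs
        induction s, hs using Nat.le_induction with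
        | base => exact hd
        | succ s _ ih => rw [hrun_succ, ih, Option.bind_some, hfinal d N hfin]
      exact h N ((le_max_right _ _).trans hN)
    simp only [φ, columns_length, hN', Option.map_some, Option.getD_some, LogConf.output,
      if_pos hfin]
    have h := hdc.2.2 0 0
    rw [hres] at h
    rcases hr : d.read 0 0 with w | a <;> rw [hr] at h
    · exact h.2
    · exact h.elim

end GTM

namespace GTM

/-! ## Realization of statements and machines -/

section Simulation

variable {A : Type} [Alphabet A] {F : GTMFrame} {Y : Fin (F.L + 1) → Type u}
  {Z : Fin (F.L + 1) → Type v} (δ : ∀ i, MultiFun (Y i) (Z i))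

/-- The relation between cell contents induced by a multi-function. -/
def CellRel {U : Type u} {V : Type v} {Γ : Type} (ε : MultiFun U V) : U ⊕ Γ → V ⊕ Γ → Prop :=
  Sum.LiftRel (fun y z => z ∈ ε y) Eq

/-- Corresponding configurations. -/
def ConfRel (c : Conf F Y) (d : Conf F Z) : Prop :=
  c.label = d.label ∧ c.head = d.head ∧ ∀ i m, CellRel (δ i) (c.tape i m) (d.tape i m)

/-- Whenever the statement `s'` can be executed, the statement `s` can be executed in each
corresponding configuration, and all its results correspond to results of `s'`. -/
def StmtSim (s : Stmt A F Y) (s' : Stmt A F Z) : Prop :=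
  ∀ c d, ConfRel δ c d → (∃ d', Exec s' d d') →
    (∃ c', Exec s c c') ∧ ∀ c', Exec s c c' → ∃ d', Exec s' d d' ∧ ConfRel δ c' d'

variable {δ}

theorem ConfRel.scan {c : Conf F Y} {d : Conf F Z} (h : ConfRel δ c d) (i : Fin (F.L + 1)) :
    CellRel (δ i) (c.scan i) (d.scan i) := by
  simp only [Conf.scan, h.2.1]
  exact h.2.2 _ _

theorem ConfRel.goto {c : Conf F Y} {d : Conf F Z} (h : ConfRel δ c d) (l : F.Label) :
    ConfRel δ (c.goto l) (d.goto l) :=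
  ⟨rfl, h.2.1, h.2.2⟩

theorem ConfRel.setHead {c : Conf F Y} {d : Conf F Z} (h : ConfRel δ c d) (i : Fin (F.L + 1))
    (m : ℤ) : ConfRel δ (c.setHead i m) (d.setHead i m) :=
  ⟨h.1, by simp only [Conf.setHead, h.2.1], h.2.2⟩

theorem ConfRel.setCell {c : Conf F Y} {d : Conf F Z} (h : ConfRel δ c d) (i : Fin (F.L + 1))
    {x : Y i ⊕ F.Γ} {y : Z i ⊕ F.Γ} (hxy : CellRel (δ i) x y) :
    ConfRel δ (c.setCell i x) (d.setCell i y) := by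
  refine ⟨h.1, h.2.1, fun j m => ?_⟩
  simp only [Conf.setCell, h.2.1]
  by_cases hj : j = i
  · subst hj
    by_cases hm : m = d.head j
    · subst hm
      simpa using hxy
    · simpa [hm] using h.2.2 j m
  · simpa [hj] using h.2.2 j m

theorem ConfRel.scan_eq_inr_iff {c : Conf F Y} {d : Conf F Z} (h : ConfRel δ c d)
    (i : Fin (F.L + 1)) (a : F.Γ) : c.scan i = .inr a ↔ d.scan i = .inr a := by
  have h' := h.scan i
  revert h'
  generalize c.scan i = x
  generalize d.scan i = y
  rintro (⟨_⟩ | ⟨rfl⟩) <;> simp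

theorem ConfRel.exists_inl {c : Conf F Y} {d : Conf F Z} (h : ConfRel δ c d) {n : ℕ}
    {t : Fin n → Fin (F.L + 1)} {z : ∀ j, Z (t j)} (hz : ∀ j, d.scan (t j) = .inl (z j)) :
    ∃ y : ∀ j, Y (t j), (∀ j, c.scan (t j) = .inl (y j)) ∧ ∀ j, z j ∈ δ (t j) (y j) := by
  have hy : ∀ j, ∃ y : Y (t j), c.scan (t j) = .inl y ∧ z j ∈ δ (t j) y := by
    intro j
    have h' := h.scan (t j)
    rw [hz j] at h'
    revert h'
    generalize c.scan (t j) = x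
    rintro ⟨h'⟩
    exact ⟨_, rfl, h'⟩
  choose y h₁ h₂ using hy
  exact ⟨y, h₁, h₂⟩

theorem stmtSim_right (i : Fin (F.L + 1)) (l : F.Label) :
    StmtSim δ (A := A) (.right i l) (.right i l) := by
  refine fun c d h _ => ⟨⟨_, rfl⟩, ?_⟩
  rintro c' rfl
  refine ⟨_, rfl, ?_⟩
  rw [h.2.1]
  exact (h.setHead i _).goto l

theorem stmtSim_left (i : Fin (F.L + 1)) (l : F.Label) :
    StmtSim δ (A := A) (.left i l) (.left i l) := by
  refine fun c d h _ => ⟨⟨_, rfl⟩, ?_⟩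
  rintro c' rfl
  refine ⟨_, rfl, ?_⟩
  rw [h.2.1]
  exact (h.setHead i _).goto l

theorem stmtSim_write (i : Fin (F.L + 1)) (a : F.Γ) (l : F.Label) :
    StmtSim δ (A := A) (.write i a l) (.write i a l) := by
  refine fun c d h _ => ⟨⟨_, rfl⟩, ?_⟩
  rintro c' rfl
  exact ⟨_, rfl, (h.setCell i (.inr rfl)).goto l⟩

theorem stmtSim_ifSym (i : Fin (F.L + 1)) (a : F.Γ) (l l' : F.Label) :
    StmtSim δ (A := A) (.ifSym i a l l') (.ifSym i a l l') := by
  refine fun c d h _ => ⟨?_, ?_⟩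
  · by_cases ha : c.scan i = .inr a
    · exact ⟨_, .inl ⟨ha, rfl⟩⟩
    · exact ⟨_, .inr ⟨ha, rfl⟩⟩
  · rintro c' (⟨ha, rfl⟩ | ⟨ha, rfl⟩)
    · exact ⟨_, .inl ⟨(h.scan_eq_inr_iff i a).1 ha, rfl⟩, h.goto l⟩
    · exact ⟨_, .inr ⟨mt (h.scan_eq_inr_iff i a).2 ha, rfl⟩, h.goto l'⟩

theorem stmtSim_assign (i : Fin (F.L + 1)) {n : ℕ} (t : Fin n → Fin (F.L + 1))
    {g : MultiFun (∀ j, Y (t j)) (Y i)} {f : MultiFun (∀ j, Z (t j)) (Z i)} (l : F.Label)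
    (hgf : Realizes (fun j => δ (t j)) (δ i) g f) :
    StmtSim δ (A := A) (.assign i t g l) (.assign i t f l) := by
  rintro c d h ⟨_, z, hz, w, hw, -⟩
  obtain ⟨y, hy, hyz⟩ := h.exists_inl hz
  obtain ⟨⟨v, hv⟩, hall⟩ := hgf y z hyz ⟨w, hw⟩
  refine ⟨⟨_, y, hy, v, hv, rfl⟩, ?_⟩
  rintro c' ⟨y', hy', v', hv', rfl⟩
  obtain rfl : y' = y := funext fun j => Sum.inl.inj ((hy' j).symm.trans (hy j))
  -- The value of `f` depends on the value `v'` already chosen by `g`.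
  obtain ⟨w', hw', hvw⟩ := hall v' hv'
  exact ⟨_, ⟨z, hz, w', hw', rfl⟩, (h.setCell i (.inl hvw)).goto l⟩

/-- Words represent themselves, so each value of `g` is a value of `f`, and both tests branch alike.
-/
theorem stmtSim_test {n : ℕ} (t : Fin n → Fin (F.L + 1))
    {g : MultiFun (∀ j, Y (t j)) (List A)} (hg : g.IsPartialFun)
    (hg' : ∀ x, g x ⊆ {wordZero A, wordOne A})
    {f : MultiFun (∀ j, Z (t j)) (List A)} (hf : f.IsPartialFun)
    (hf' : ∀ x, f x ⊆ {wordZero A, wordOne A}) (l l' : F.Label)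
    (hgf : Realizes (fun j => δ (t j)) (idWord A) g f) :
    StmtSim δ (.test t g hg hg' l l') (.test t f hf hf' l l') := by
  rintro c d h ⟨_, z, hz, hw⟩
  obtain ⟨y, hy, hyz⟩ := h.exists_inl hz
  have hne : (f z).Nonempty := by
    rcases hw with ⟨hw, -⟩ | ⟨hw, -⟩
    · exact ⟨_, hw⟩
    · exact ⟨_, hw⟩
  obtain ⟨⟨v, hv⟩, hall⟩ := hgf y z hyz hne
  have hsub : ∀ v ∈ g y, v ∈ f z := by
    intro v hv
    obtain ⟨w, hw, hwv⟩ := hall v hv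
    obtain rfl : w = v := hwv
    exact hw
  refine ⟨?_, ?_⟩
  · rcases hg' y hv with rfl | rfl
    · exact ⟨_, y, hy, .inl ⟨hv, rfl⟩⟩
    · exact ⟨_, y, hy, .inr ⟨hv, rfl⟩⟩
  · rintro c' ⟨y', hy', hv'⟩
    obtain rfl : y' = y := funext fun j => Sum.inl.inj ((hy' j).symm.trans (hy j))
    rcases hv' with ⟨hv', rfl⟩ | ⟨hv', rfl⟩
    · exact ⟨_, ⟨z, hz, .inl ⟨hsub _ hv', rfl⟩⟩, h.goto l⟩
    · exact ⟨_, ⟨z, hz, .inr ⟨hsub _ hv', rfl⟩⟩, h.goto l'⟩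

theorem confRel_initConf {y : ∀ j : Fin F.k, Y (F.inTape j)} {z : ∀ j : Fin F.k, Z (F.inTape j)}
    (h : ∀ j, z j ∈ δ (F.inTape j) (y j)) : ConfRel δ (initConf y) (initConf z) := by
  refine ⟨rfl, rfl, fun i m => ?_⟩
  refine i.cases ?_ fun i => ?_
  · exact .inr rfl
  · simp only [initConf, Fin.cases_succ]
    split_ifs with hi
    · exact .inl (h ⟨i.1, hi.1⟩)
    · exact .inr rfl

/-- Without infinite computations, some reachable configuration has no successor. -/
theorem exists_reaches_terminal {α : Type*} {r : α → α → Prop} {a : α}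
    (h : ¬ ∃ s : ℕ → α, s 0 = a ∧ ∀ n, r (s n) (s (n + 1))) :
    ∃ b, Relation.ReflTransGen r a b ∧ ∀ c, ¬ r b c := by
  by_contra! hcon
  choose! f hf using hcon
  have hr : ∀ n, Relation.ReflTransGen r a (f^[n] a) := by
    intro n
    induction n with
    | zero => exact .refl
    | succ n ih =>
      rw [Function.iterate_succ_apply']
      exact ih.tail (hf _ ih)
  exact h ⟨fun n => f^[n] a, rfl, fun n => by
    dsimp only
    rw [Function.iterate_succ_apply']
    exact hf _ (hr n)⟩

/-- A machine whose statements simulate those of `P` realizes `P`. -/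
theorem realizes_computes {M : GTM A F Y} {P : GTM A F Z}
    (hMP : ∀ l, StmtSim δ (M.stm l) (P.stm l)) :
    Realizes (fun j => δ (F.inTape j)) (δ 0) M.computes P.computes := by
  rintro y z hyz ⟨z₀, ⟨hinf, hacc⟩, -⟩
  -- Both machines stop together: if `P` is stuck in `d`, then `d` is accepting because all maximal
  -- computations are, so its label, which is also that of `c`, is final.
  have key : ∀ c d, ConfRel δ c d → Relation.ReflTransGen P.Step (initConf z) d →
      (Accepting d ∧ ∀ c', ¬ M.Step c c') ∨
      ((∃ c', M.Step c c') ∧ ∀ c', M.Step c c' → ∃ d', P.Step d d' ∧ ConfRel δ c' d') := by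
    intro c d h hd
    by_cases hstuck : ∃ d', P.Step d d'
    · right
      obtain ⟨d', hl, hex⟩ := hstuck
      obtain ⟨l, tape, head⟩ := c
      obtain rfl : l = d.label := h.1
      obtain ⟨⟨c', hc'⟩, hall⟩ := hMP ⟨d.label, hl⟩ _ d h ⟨d', hex⟩
      refine ⟨⟨c', hl, hc'⟩, ?_⟩
      rintro c'' ⟨_, hc''⟩
      obtain ⟨d'', hd'', hr⟩ := hall c'' hc''
      exact ⟨d'', ⟨hl, hd''⟩, hr⟩
    · left
      have ha := hacc d hd (not_exists.1 hstuck)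
      refine ⟨ha, fun c' => not_step_of_final ?_⟩
      obtain ⟨_, hl, -⟩ := ha
      rw [h.1, hl]
  have reach : ∀ c, Relation.ReflTransGen M.Step (initConf y) c →
      ∃ d, Relation.ReflTransGen P.Step (initConf z) d ∧ ConfRel δ c d := by
    intro c hc
    induction hc with
    | refl => exact ⟨_, .refl, confRel_initConf hyz⟩
    | tail _ hs ih =>
      obtain ⟨d, hd, h⟩ := ih
      rcases key _ d h hd with ⟨-, hn⟩ | ⟨-, hall⟩
      · exact (hn _ hs).elim
      · obtain ⟨d', hd', h'⟩ := hall _ hs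
        exact ⟨d', hd.tail hd', h'⟩
  have result : ∀ c d y₀ z₀, ConfRel δ c d → AcceptsWith c y₀ → AcceptsWith d z₀ →
      z₀ ∈ δ 0 y₀ := by
    intro c d y₀ z₀ h hc hd
    have h' := h.2.2 0 0
    rw [hc.2, hd.2] at h'
    simpa [CellRel] using h'
  have accept : ∀ c d, ConfRel δ c d → Accepting d → Accepting c := by
    rintro c d h ⟨z₁, hl, hz₁⟩
    have h' := h.2.2 0 0
    rw [hz₁] at h'
    rcases hc : c.tape 0 0 with y₁ | a
    · exact ⟨y₁, h.1.trans hl, hc⟩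
    · rw [hc] at h'
      simp [CellRel] at h'
  have hM : M.AllMaximalAccepting (initConf y) := by
    refine ⟨?_, ?_⟩
    · rintro ⟨s, hs₀, hs⟩
      apply hinf
      -- An infinite computation of `M` is lifted step by step to one of `P`.
      have hstep : ∀ n d, ConfRel δ (s n) d → Relation.ReflTransGen P.Step (initConf z) d →
          ∃ d', P.Step d d' ∧ ConfRel δ (s (n + 1)) d' := by
        intro n d h hd
        rcases key _ d h hd with ⟨-, hn⟩ | ⟨-, hall⟩
        · exact (hn _ (hs n)).elim
        · exact hall _ (hs n)
      choose! f hf₁ hf₂ using hstep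
      let e : ℕ → Conf F Z := fun n => n.rec (initConf z) f
      have he : ∀ n, ConfRel δ (s n) (e n) ∧ Relation.ReflTransGen P.Step (initConf z) (e n) := by
        intro n
        induction n with
        | zero => exact ⟨by rw [hs₀]; exact confRel_initConf hyz, .refl⟩
        | succ n ih => exact ⟨hf₂ n _ ih.1 ih.2, ih.2.tail (hf₁ n _ ih.1 ih.2)⟩
      exact ⟨e, rfl, fun n => hf₁ n _ (he n).1 (he n).2⟩
    · intro c hc hterm
      obtain ⟨d, hd, h⟩ := reach c hc
      rcases key c d h hd with ⟨ha, -⟩ | ⟨⟨c', hc'⟩, -⟩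
      · exact accept c d h ha
      · exact (hterm c' hc').elim
  refine ⟨?_, ?_⟩
  -- Without infinite computations a maximal one exists, and its result shows that the value set is
  -- nonempty.
  · obtain ⟨c, hc, hterm⟩ := exists_reaches_terminal hM.1
    obtain ⟨y₀, hy₀⟩ := hM.2 c hc hterm
    exact ⟨y₀, hM, c, hc, hy₀⟩
  · rintro y₀ ⟨-, c, hc, hy₀⟩
    obtain ⟨d, hd, h⟩ := reach c hc
    rcases key c d h hd with ⟨⟨z₁, hz₁⟩, -⟩ | ⟨⟨c', hc'⟩, -⟩
    · exact ⟨z₁, ⟨⟨hinf, hacc⟩, d, hd, hz₁⟩, result c d y₀ z₁ h hy₀ hz₁⟩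
    · exact (not_step_of_final hy₀.1 hc').elim

end Simulation

theorem stmtSim_of_replaces {A : Type} [Alphabet A] {F : GTMFrame} {Y : Fin (F.L + 1) → Type u}
    {Z : Fin (F.L + 1) → Type v} {γ : ∀ i, MultiFun (ℕ → A) (Y i)}
    {δ : ∀ i, MultiFun (Y i) (Z i)} {s : Stmt A F Y} {s' : Stmt A F Z}
    (h : StmtReplaces γ δ s s') : StmtSim δ s s' := by
  cases h with
  | right i l => exact stmtSim_right i l
  | left i l => exact stmtSim_left i l
  | write i a l => exact stmtSim_write i a l
  | ifSym i a l l' => exact stmtSim_ifSym i a l l'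
  | assign i t g f l hr => exact stmtSim_assign i t l hr
  | test t g hg hg' f hf hf' l l' hr => exact stmtSim_test t hg hg' hf hf' l l' hr

/-! ## Realization by machines on infinite sequences -/

section Sequences

variable {A : Type} [Alphabet A] {F : GTMFrame}

/-- The statement has at most one result. -/
def StmtDet {X : Fin (F.L + 1) → Type u} (s : Stmt A F X) : Prop :=
  Relator.RightUnique (Exec s)

theorem wordZero_ne_wordOne : wordZero A ≠ wordOne A := by
  simpa [wordZero, wordOne] using Alphabet.zero_ne_one

/-- Only an assignment can have several outcomes, since tests are partial functions by definition.
-/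
theorem stmtDet_of_realizable {X : Fin (F.L + 1) → Type u} (s : Stmt A F X)
    (h : ∀ (i : Fin (F.L + 1)) (n : ℕ) (t : Fin n → Fin (F.L + 1))
      (f : MultiFun (∀ j, X (t j)) (X i)) (l : F.Label), s = .assign i t f l → f.IsPartialFun) :
    StmtDet s := by
  intro c c' c'' h' h''
  cases s with
  | right i l => exact h'.trans h''.symm
  | left i l => exact h'.trans h''.symm
  | write i a l => exact h'.trans h''.symm
  | ifSym i a l l' =>
    rcases h' with ⟨h', rfl⟩ | ⟨h', rfl⟩ <;> rcases h'' with ⟨h'', rfl⟩ | ⟨h'', rfl⟩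
    · rfl
    · exact (h'' h').elim
    · exact (h' h'').elim
    · rfl
  | assign i t f l =>
    obtain ⟨x, hx, y, hy, rfl⟩ := h'
    obtain ⟨x', hx', y', hy', rfl⟩ := h''
    obtain rfl : x = x' := funext fun j => Sum.inl.inj ((hx j).symm.trans (hx' j))
    rw [h i _ t f l rfl x hy hy']
  | test t f hf hf' l l' =>
    obtain ⟨x, hx, hy⟩ := h'
    obtain ⟨x', hx', hy'⟩ := h''
    obtain rfl : x = x' := funext fun j => Sum.inl.inj ((hx j).symm.trans (hx' j))
    rcases hy with ⟨hy, rfl⟩ | ⟨hy, rfl⟩ <;> rcases hy' with ⟨hy', rfl⟩ | ⟨hy', rfl⟩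
    · rfl
    · exact (wordZero_ne_wordOne (hf x hy hy')).elim
    · exact (wordZero_ne_wordOne (hf x hy' hy)).elim
    · rfl

variable {Y : Fin (F.L + 1) → Type u} {Z : Fin (F.L + 1) → Type v}

/-- The restriction of a word-valued multi-function to those arguments where it has exactly one
value, and this value is `0` or `1`. -/
def boolPart {U : Type u} (g : MultiFun U (List A)) : MultiFun U (List A) :=
  fun x => {w | g x = {w} ∧ (w = wordZero A ∨ w = wordOne A)}

theorem boolPart_isPartialFun {U : Type u} (g : MultiFun U (List A)) :
    (boolPart g).IsPartialFun := by
  rintro x w ⟨hw, -⟩ w' ⟨hw', -⟩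
  exact Set.singleton_injective (hw.symm.trans hw')

theorem boolPart_subset {U : Type u} (g : MultiFun U (List A)) (x : U) :
    boolPart g x ⊆ {wordZero A, wordOne A} := fun _ h => h.2

theorem boolPart_le {U : Type u} (g : MultiFun U (List A)) (x : U) : boolPart g x ⊆ g x := by
  rintro w ⟨hw, -⟩
  rw [hw]
  rfl

/-- A test is realized by the restriction of any realization to its `0`-`1`-valued part. -/
theorem realizes_boolPart {n : ℕ} {U : Fin n → Type u} {V : Fin n → Type v}
    {ε : ∀ j, MultiFun (U j) (V j)} {g : MultiFun (∀ j, U j) (List A)}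
    {f : MultiFun (∀ j, V j) (List A)} (hf : f.IsPartialFun)
    (hf' : ∀ x, f x ⊆ {wordZero A, wordOne A}) (h : Realizes ε (idWord A) g f) :
    Realizes ε (idWord A) (boolPart g) f := by
  intro x y hxy hne
  obtain ⟨⟨w, hw⟩, hall⟩ := h x y hxy hne
  have hsub : ∀ v ∈ g x, v ∈ f y := by
    intro v hv
    obtain ⟨w, hw, hwv⟩ := hall v hv
    obtain rfl : w = v := hwv
    exact hw
  refine ⟨⟨w, ?_, hf' y (hsub w hw)⟩, fun v hv => hall v (boolPart_le g x hv)⟩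
  exact Set.eq_singleton_iff_unique_mem.2 ⟨hw, fun v hv => hf y (hsub v hv) (hsub w hw)⟩

/-- Where `boolPart g` is defined, `g` has a single value, and the same realizer must produce it. -/
theorem relComputableWord_boolPart {n : ℕ} {U : Fin n → Type u}
    {γ : ∀ j, MultiFun (ℕ → A) (U j)} {g : MultiFun (∀ j, U j) (List A)}
    (h : RelComputableWord γ g) : RelComputableWord γ (boolPart g) := by
  obtain ⟨f, hf, hr⟩ := h
  refine ⟨f, hf, fun x y hxy hne => ?_⟩
  obtain ⟨w, hw, hw'⟩ := hne
  obtain ⟨hne, hall⟩ := hr x y hxy ⟨w, by rw [hw]; rfl⟩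
  refine ⟨hne, fun v hv => ?_⟩
  obtain ⟨v', hv', hvv⟩ := hall v hv
  rw [hw] at hv'
  obtain rfl : v' = w := hv'
  exact ⟨v', ⟨hw, hw'⟩, hvv⟩

/-- A statement all of whose functions are computable is realized by a statement on infinite
sequences all of whose functions are computed by Type-2 machines. -/
theorem exists_stmt_on_sequences [Finite A] [Primcodable A] [Primcodable F.Label]
    [Primcodable F.Γ] {γ : ∀ i, MultiFun (ℕ → A) (Y i)} {δ : ∀ i, MultiFun (Y i) (Z i)}
    {s : Stmt A F Y} {s' : Stmt A F Z} (h : StmtReplaces γ δ s s') :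
    ∃ r : Stmt A F fun _ => ℕ → A, StmtSim γ r s ∧ StmtDet r ∧ StmtApprox r := by
  cases h with
  | right i l =>
    exact ⟨.right i l, stmtSim_right i l, stmtDet_of_realizable _ (by rintro _ _ _ _ _ ⟨⟩),
      stmtApprox_right i l⟩
  | left i l =>
    exact ⟨.left i l, stmtSim_left i l, stmtDet_of_realizable _ (by rintro _ _ _ _ _ ⟨⟩),
      stmtApprox_left i l⟩
  | write i a l =>
    exact ⟨.write i a l, stmtSim_write i a l, stmtDet_of_realizable _ (by rintro _ _ _ _ _ ⟨⟩),
      stmtApprox_write i a l⟩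
  | ifSym i a l l' =>
    exact ⟨.ifSym i a l l', stmtSim_ifSym i a l l',
      stmtDet_of_realizable _ (by rintro _ _ _ _ _ ⟨⟩), stmtApprox_ifSym i a l l'⟩
  | assign i t g f l _ hc =>
    obtain ⟨h, ⟨-, M, hM⟩, hr⟩ := hc
    -- The full function `M.seqFun` extends the realizer `h`; being single-valued, it adds no
    -- further value where `h` is defined.
    refine ⟨.assign i t M.seqFun l, stmtSim_assign i t l ?_, stmtDet_of_realizable _ ?_,
      stmtApprox_assign i t M l⟩
    · intro x y hxy hne
      obtain ⟨⟨q, hq⟩, hall⟩ := hr x y hxy hne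
      refine ⟨⟨q, hM x q hq⟩, fun q' hq' => ?_⟩
      rw [Type2Machine.seqFun_unique hq' (hM x q hq)]
      exact hall q hq
    · rintro _ _ _ _ _ ⟨⟩ x q hq q' hq'
      exact Type2Machine.seqFun_unique hq hq'
  | test t g hg hg' f hf hf' l l' _ hc =>
    obtain ⟨h, ⟨hp, M, hM⟩, hr⟩ := hc
    -- Away from the relevant inputs `h` may take words other than `0` and `1`, which a test does
    -- not allow.
    exact ⟨.test t (boolPart h) (boolPart_isPartialFun h) (boolPart_subset h) l l',
      stmtSim_test t _ _ hg hg' l l' (realizes_boolPart hg hg' hr),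
      stmtDet_of_realizable _ (by rintro _ _ _ _ _ ⟨⟩),
      stmtApprox_test t M _ (fun p w hw => hM p w (boolPart_le h p hw)) _ _ l l'⟩

/-- A machine obtained from another one by replacing functions by computable realizations
computes a computable multi-function. -/
theorem relComputable_computes {γ : ∀ i, MultiFun (ℕ → A) (Y i)} {δ : ∀ i, MultiFun (Y i) (Z i)}
    {M : GTM A F Y} {P : GTM A F Z} (h : M.ObtainedFrom γ δ P) :
    RelComputable (fun j => γ (F.inTape j)) (γ 0) M.computes := by
  have : Finite A := Alphabet.finite
  have := F.labelFinite
  have := F.symFinite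
  let _ := finitePrimcodable A
  let _ := finitePrimcodable F.Label
  let _ := finitePrimcodable F.Γ
  choose r hr hdet happrox using fun l => exists_stmt_on_sequences (h l)
  -- The simulation principle via `γ`: the machine `r` is to `M` what `M` is to `P`.
  refine ⟨computes (X := fun _ => ℕ → A) ⟨r⟩, isComputableSeqFun_computes ?_ happrox,
    realizes_computes (M := ⟨r⟩) hr⟩
  rintro c c' c'' ⟨hl, h'⟩ ⟨_, h''⟩
  exact hdet _ h' h''

end Sequences

end GTM

/-! ### Composition of representations, and the theorem -/

theorem RelComputable.relComp {A : Type} {n : ℕ} {Y : Fin n → Type u} {Z : Fin n → Type v}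
    {Y₀ : Type w} {Z₀ : Type z} {γ : ∀ j, MultiFun (ℕ → A) (Y j)} {γ₀ : MultiFun (ℕ → A) Y₀}
    {δ : ∀ j, MultiFun (Y j) (Z j)} {δ₀ : MultiFun Y₀ Z₀} {g : MultiFun (∀ j, Y j) Y₀}
    {f : MultiFun (∀ j, Z j) Z₀} (hg : RelComputable γ γ₀ g) (hf : Realizes δ δ₀ g f) :
    RelComputable (fun j => (δ j).relComp (γ j)) (δ₀.relComp γ₀) f := by
  obtain ⟨h, hc, hr⟩ := hg
  refine ⟨h, hc, fun x z hxz hne => ?_⟩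
  choose y hxy hyz using hxz
  obtain ⟨hgne, hgall⟩ := hf y z hyz hne
  obtain ⟨hhne, hhall⟩ := hr x y hxy hgne
  refine ⟨hhne, fun x₀ hx₀ => ?_⟩
  obtain ⟨y₀, hy₀, hxy₀⟩ := hhall x₀ hx₀
  obtain ⟨z₀, hz₀, hyz₀⟩ := hgall y₀ hy₀
  exact ⟨z₀, hz₀, y₀, hxy₀, hyz₀⟩

theorem theoremt5 {A : Type} [Alphabet A] (F : GTMFrame)
    (Y : Fin (F.L + 1) → Type u) (Z : Fin (F.L + 1) → Type v)
    (P : GTM A F Z)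
    (δ : ∀ i, MultiFun (Y i) (Z i)) (hδ : ∀ i, (δ i).IsMultiRep)
    (γ : ∀ i, MultiFun (ℕ → A) (Y i)) (hγ : ∀ i, (γ i).IsMultiRep)
    (hassign : ∀ (l : {l : F.Label // l ≠ F.final}) (i : Fin (F.L + 1)) (n : ℕ)
      (t : Fin n → Fin (F.L + 1)) (f : MultiFun (∀ j, Z (t j)) (Z i)) (l' : F.Label),
      P.stm l = .assign i t f l' →
        ∃ g : MultiFun (∀ j, Y (t j)) (Y i),
          Realizes (fun j => δ (t j)) (δ i) g f ∧ RelComputable (fun j => γ (t j)) (γ i) g)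
    (htest : ∀ (l : {l : F.Label // l ≠ F.final}) (n : ℕ)
      (t : Fin n → Fin (F.L + 1)) (f : MultiFun (∀ j, Z (t j)) (List A))
      (hf : f.IsPartialFun) (hf' : ∀ x, f x ⊆ {wordZero A, wordOne A}) (l' l'' : F.Label),
      P.stm l = .test t f hf hf' l' l'' →
        ∃ g : MultiFun (∀ j, Y (t j)) (List A),
          Realizes (fun j => δ (t j)) (idWord A) g f ∧
            RelComputableWord (fun j => γ (t j)) g) :
    (∃ M : GTM A F Y, M.ObtainedFrom γ δ P) ∧
    (∀ M : GTM A F Y, M.ObtainedFrom γ δ P →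
      RelComputable (fun j => γ (F.inTape j)) (γ 0) M.computes ∧
      Realizes (fun j => δ (F.inTape j)) (δ 0) M.computes P.computes) ∧
    RelComputable (fun j => (δ (F.inTape j)).relComp (γ (F.inTape j)))
      ((δ 0).relComp (γ 0)) P.computes := by
  have hex : ∃ M : GTM A F Y, M.ObtainedFrom γ δ P := by
    have hs : ∀ l, ∃ s : Stmt A F Y, StmtReplaces γ δ s (P.stm l) := by
      intro l
      have ha := hassign l
      have ht := htest l
      revert ha ht
      cases P.stm l with
      | right i l' => exact fun _ _ => ⟨_, .right i l'⟩
      | left i l' => exact fun _ _ => ⟨_, .left i l'⟩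
      | write i a l' => exact fun _ _ => ⟨_, .write i a l'⟩
      | ifSym i a l' l'' => exact fun _ _ => ⟨_, .ifSym i a l' l''⟩
      | assign i t f l' =>
        intro ha _
        obtain ⟨g, hr, hc⟩ := ha i _ t f l' rfl
        exact ⟨_, .assign i t g f l' hr hc⟩
      | test t f hf hf' l' l'' =>
        intro _ ht
        obtain ⟨g, hr, hc⟩ := ht _ t f hf hf' l' l'' rfl
        -- The given `g` may be multi-valued or take other words, so it need not be admissible in a
        -- test; its part with exactly one value, `0` or `1`, is, and still realizes `f`.
        exact ⟨_, .test t (GTM.boolPart g) (GTM.boolPart_isPartialFun g) (GTM.boolPart_subset g)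
          f hf hf' l' l'' (GTM.realizes_boolPart hf hf' hr) (GTM.relComputableWord_boolPart hc)⟩
    choose s hs using hs
    exact ⟨⟨s⟩, hs⟩
  have hall : ∀ M : GTM A F Y, M.ObtainedFrom γ δ P →
      RelComputable (fun j => γ (F.inTape j)) (γ 0) M.computes ∧
      Realizes (fun j => δ (F.inTape j)) (δ 0) M.computes P.computes := fun M hM =>
    ⟨GTM.relComputable_computes hM,
      GTM.realizes_computes fun l => GTM.stmtSim_of_replaces (hM l)⟩
  obtain ⟨M, hM⟩ := hex
  exact ⟨⟨M, hM⟩, hall, (hall M hM).1.relComp (hall M hM).2⟩
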